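/- Elementary gates are the one-qubit unitaries and the CNOT gate; the size of a circuit is its number of elementary gates. A circuit $C$ on $n+m$ qubits prepares an $n$-qubit state $|\phi\rangle$ with $m$ ancillary qubits if $C\,|0^n\rangle|0^m\rangle=|\phi\rangle|0^m\rangle$. Classical complexity is the number of steps of a fixed program on a unit-cost real RAM (registers and indirectly addressed arrays of natural numbers, with addition and subtraction of constants and comparisons; registers and arrays of complex numbers, with exact field operations, conjugation, real square roots and comparison of real parts; an output tape to which the elementary gates are written one per step). Its input consists of $n$, $k$ and the list of the amplitudes $c_x$, $|x|=k$, in lexicographic order of the strings $x$. **Corollary ($U(1)$-invariant states).** There are a program and absolute constants $a,K$ such that the following holds for all integers $n\ge 2$ and $0\le k<n$. Let $$|\phi\rangle=\sum_{x\in\{0,1\}^n,\ |x|=k}c_x|x\rangle,\qquad \sum_{|x|=k}|c_x|^2=1,$$ be any $U(1)$-invariant state, where $|x|$ is the Hamming weight of $x$. Then $|\phi\rangle$ is prepared by a circuit of size at most $K\binom nk\log_2 n$ with at most $a\,n$ ancillary qubits. Moreover, the program, given $n$, $k$ and the amplitudes $(c_x)_{|x|=k}$, outputs this circuit within $K\binom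 nk\log_2 n$ steps. -/

import Mathlib

namespace U1Prep

/-! ### Quantum states and circuits -/

/-- A vector of `n` qubits, by its amplitudes in the computational basis
(`false` is `|0⟩`, `true` is `|1⟩`). -/
abbrev QVec (n : ℕ) : Type := (Fin n → Bool) → ℂ

/-- Hamming weight of a binary string. -/
def weight {n : ℕ} (x : Fin n → Bool) : ℕ := (Finset.univ.filter fun i => x i = true).card

/-- `ψ` is a normalized state of the form `∑_{|x| = k} c_x |x⟩`. -/
structure IsU1State {n : ℕ} (k : ℕ) (ψ : QVec n) : Prop where
  normalized : ∑ x, ‖ψ x‖ ^ 2 = 1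
  support : ∀ x, weight x ≠ k → ψ x = 0

/-- Elementary gates on `N` qubits: arbitrary one-qubit unitaries, and CNOT gates. -/
inductive Gate (N : ℕ) : Type
  | one (q : Fin N) (U : Matrix.unitaryGroup Bool ℂ) : Gate N
  | cnot (control target : Fin N) (h : control ≠ target) : Gate N

/-- The action of an elementary gate on a vector. -/
noncomputable def Gate.apply {N : ℕ} : Gate N → QVec N → QVec N
  | .one q U, φ => fun x => ∑ b : Bool, (U : Matrix Bool Bool ℂ) (x q) b * φ (Function.update x q b)
  | .cnot c t _, φ => fun x => φ (Function.update x t (xor (x t) (x c)))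

/-- A circuit is a sequence of elementary gates, the first one being applied first;
its size is its length. -/
abbrev Circuit (N : ℕ) : Type := List (Gate N)

/-- The action of a circuit on a vector. -/
noncomputable def Circuit.run {N : ℕ} (C : Circuit N) (φ : QVec N) : QVec N :=
  C.foldl (fun v g => g.apply v) φ

/-- The basis state `|0 … 0⟩`. -/
def zeroState (N : ℕ) : QVec N := fun x => if x = (fun _ => false) then 1 else 0

/-- The product `|φ⟩|χ⟩` on the first `n` and the last `m` qubits. -/
def tensor {n m : ℕ} (φ : QVec n) (χ : QVec m) : QVec (n + m) :=
  fun x => φ (fun i => x (Fin.castAdd m i)) * χ (fun j => x (Fin.natAdd n j))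

/-- `C (|0^n⟩|0^m⟩) = |ψ⟩|0^m⟩`: the circuit prepares `ψ` with `m` ancillary qubits. -/
def Prepares {n m : ℕ} (C : Circuit (n + m)) (ψ : QVec n) : Prop :=
  Circuit.run C (tensor (zeroState n) (zeroState m)) = tensor ψ (zeroState m)

/-! ### The classical machine: a real RAM, with unit cost

The machine has registers and arrays of natural numbers and of complex numbers. On natural numbers
it only moves data, adds or subtracts constants, and compares, so that after `t` steps every natural
number it holds is at most its input parameters plus `O(t)` (words of logarithmic length). On complex
numbers (pairs of reals) it has exact field operations, conjugation and real square roots.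
It writes a list of elementary gates to an output tape. -/

/-- A description of a gate, as written on the output tape. -/
inductive GateCode : Type
  | one (q : ℕ) (U : Matrix Bool Bool ℂ) : GateCode
  | cnot (control target : ℕ) : GateCode

/-- The description of a gate. -/
def Gate.code {N : ℕ} : Gate N → GateCode
  | .one q U => .one q U
  | .cnot c t _ => .cnot c t

/-- The memory of the machine. -/
structure Store : Type where
  /-- natural-number registers -/
  reg : ℕ → ℕ
  /-- natural-number arrays: name, then index -/
  arr : ℕ → ℕ → ℕ
  /-- complex registers -/
  creg : ℕ → ℂ
  /-- complex arrays: name, then index -/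
  carr : ℕ → ℕ → ℂ
  /-- output tape -/
  out : List GateCode

/-- Elementary instructions. All parameters are constants of the program; parameters that name
registers or arrays are fixed names, and arrays are addressed indirectly through a register. -/
inductive Instr : Type
  | skip : Instr
  | const (r v : ℕ) : Instr
  | addConst (r s v : ℕ) : Instr
  | subConst (r s v : ℕ) : Instr
  | load (r a i : ℕ) : Instr
  | store (a i r : ℕ) : Instr
  | cconst (r : ℕ) (p q : ℚ) : Instr
  | cadd (r s t : ℕ) : Instr
  | csub (r s t : ℕ) : Instr
  | cmul (r s t : ℕ) : Instr
  | cdiv (r s t : ℕ) : Instr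
  | cconj (r s : ℕ) : Instr
  | csqrt (r s : ℕ) : Instr
  | cload (r a i : ℕ) : Instr
  | cstore (a i r : ℕ) : Instr
  | emitOne (q u₀₀ u₀₁ u₁₀ u₁₁ : ℕ) : Instr
  | emitCnot (control target : ℕ) : Instr

/-- Write a natural-number register. -/
def Store.setReg (σ : Store) (r v : ℕ) : Store := { σ with reg := Function.update σ.reg r v }

/-- Write a complex register. -/
noncomputable def Store.setCreg (σ : Store) (r : ℕ) (z : ℂ) : Store :=
  { σ with creg := Function.update σ.creg r z }

/-- The effect of an instruction. Division by `0` returns `0`, subtraction of natural numbers is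
truncated, and `csqrt` takes the square root of the real part (`0` if that is negative). -/
noncomputable def Instr.exec : Instr → Store → Store
  | .skip, σ => σ
  | .const r v, σ => σ.setReg r v
  | .addConst r s v, σ => σ.setReg r (σ.reg s + v)
  | .subConst r s v, σ => σ.setReg r (σ.reg s - v)
  | .load r a i, σ => σ.setReg r (σ.arr a (σ.reg i))
  | .store a i r, σ =>
      { σ with arr := Function.update σ.arr a (Function.update (σ.arr a) (σ.reg i) (σ.reg r)) }
  | .cconst r p q, σ => σ.setCreg r ((p : ℂ) + (q : ℂ) * Complex.I)
  | .cadd r s t, σ => σ.setCreg r (σ.creg s + σ.creg t)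
  | .csub r s t, σ => σ.setCreg r (σ.creg s - σ.creg t)
  | .cmul r s t, σ => σ.setCreg r (σ.creg s * σ.creg t)
  | .cdiv r s t, σ => σ.setCreg r (σ.creg s / σ.creg t)
  | .cconj r s, σ => σ.setCreg r (starRingEnd ℂ (σ.creg s))
  | .csqrt r s, σ => σ.setCreg r ((Real.sqrt (σ.creg s).re : ℝ) : ℂ)
  | .cload r a i, σ => σ.setCreg r (σ.carr a (σ.reg i))
  | .cstore a i r, σ =>
      { σ with carr := Function.update σ.carr a (Function.update (σ.carr a) (σ.reg i) (σ.creg r)) }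
  | .emitOne q u₀₀ u₀₁ u₁₀ u₁₁, σ =>
      { σ with out := σ.out ++ [.one (σ.reg q) (Matrix.of fun i j =>
          σ.creg (if i then (if j then u₁₁ else u₁₀) else (if j then u₀₁ else u₀₀)))] }
  | .emitCnot c t, σ => { σ with out := σ.out ++ [.cnot (σ.reg c) (σ.reg t)] }

/-- Tests: comparisons of two natural-number registers, or of the real parts of two complex
registers. -/
inductive Test : Type
  | eq (r s : ℕ) : Test
  | lt (r s : ℕ) : Test
  | reLe (r s : ℕ) : Test

/-- The truth of a test. -/
def Test.holds : Test → Store → Prop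
  | .eq r s, σ => σ.reg r = σ.reg s
  | .lt r s, σ => σ.reg r < σ.reg s
  | .reLe r s, σ => (σ.creg r).re ≤ (σ.creg s).re

/-- Programs. -/
inductive Prog : Type
  | instr (i : Instr) : Prog
  | seq (p q : Prog) : Prog
  | ite (b : Test) (p q : Prog) : Prog
  | loop (b : Test) (p : Prog) : Prog

/-- `Exec p σ t τ`: started in the memory `σ`, the program `p` halts in the memory `τ` after
exactly `t` steps. Every instruction and every evaluation of a test is one step; `loop b p`
repeats `p` as long as `b` holds. -/
inductive Exec : Prog → Store → ℕ → Store → Prop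
  | instr (i : Instr) (σ : Store) : Exec (.instr i) σ 1 (i.exec σ)
  | seq {p q : Prog} {σ τ υ : Store} {t u : ℕ} (h₁ : Exec p σ t τ) (h₂ : Exec q τ u υ) :
      Exec (.seq p q) σ (t + u) υ
  | iteTrue {b : Test} {p q : Prog} {σ τ : Store} {t : ℕ} (hb : b.holds σ) (h : Exec p σ t τ) :
      Exec (.ite b p q) σ (t + 1) τ
  | iteFalse {b : Test} {p q : Prog} {σ τ : Store} {t : ℕ} (hb : ¬ b.holds σ) (h : Exec q σ t τ) :
      Exec (.ite b p q) σ (t + 1) τ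
  | loopDone {b : Test} {p : Prog} {σ : Store} (hb : ¬ b.holds σ) : Exec (.loop b p) σ 1 σ
  | loopStep {b : Test} {p : Prog} {σ τ υ : Store} {t u : ℕ} (hb : b.holds σ)
      (h₁ : Exec p σ t τ) (h₂ : Exec (.loop b p) τ u υ) : Exec (.loop b p) σ (t + u + 1) υ

/-- The binary strings of length `n` and Hamming weight `k`, in lexicographic order
(coordinate `0` is compared first, and `0` precedes `1`). -/
noncomputable def weightList (n k : ℕ) : List (Fin n → Bool) :=
  ((Finset.univ.filter fun x : Lex (Fin n → Bool) => weight (ofLex x) = k).sort (· ≤ ·)).map ofLex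

/-- The input: `n` and `k` in the natural-number registers `0` and `1`, and in the complex array `0`
the amplitudes `c_x`, `|x| = k`, listed in the lexicographic order of the strings `x`.
Everything else is zero, and the output tape is empty. -/
noncomputable def input {n : ℕ} (k : ℕ) (ψ : QVec n) : Store where
  reg := fun r => if r = 0 then n else if r = 1 then k else 0
  arr := fun _ _ => 0
  creg := fun _ => 0
  carr := fun a j => if a = 0 then ((weightList n k).map ψ).getD j 0 else 0
  out := []

end U1Prep

/-! Read the strings of weight `k` in lexicographic order as the leaves of a binary decision tree:
level `i` decides bit `i`, the left child being bit 0. Give every leaf its amplitude and every inner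
node the norm of the leaves below it. The state is then prepared by descending the tree with one
controlled one-qubit operation per inner node, sending `|0⟩` of bit `i` to the two children in the
ratio of their amplitudes.

The control is cheap because of unary flags. The ancilla `n + i` says whether a basis string passes
through the node currently treated at level `i`, so an operation at a node needs one control only,
and moving to a child takes boundedly many gates. While one branch is treated, all deeper flags of
the other branch are down and the circuit of the subtree fixes it (`Tree.codeRun_of_false`). This
gives the induction `Tree.codeRun_eq_target`. All flags are down again when a node is left.

For the count, let `f` be the majority bit (0 in a tie), called the default; the other bit is
exceptional. The circuit works with the bits of `x xor f`, so that default bits are untouched zeros,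
and a branch ends as soon as no exceptional bits remain. The budget of default bits is raised by
one: a path may thus run until its last exceptional bit is placed, and a path that uses the surplus
default bit dies in `Tree.nil`. By Pascal's rule the inner nodes number one less than a binomial
coefficient in `n + 1` (`Tree.nodes_add_one`), which is at most twice `n.choose k` precisely because
the exceptional bit is the minority (`nodes_le`). Phases cost nothing: a genuine leaf is always an
exceptional child of its parent, unless it is the root, and the rotation may give that child any
complex amplitude, while the default child has a nonnegative real one. For `k = 0` the tree is a
single leaf, and one scalar gate does.

The classical program is a depth-first traversal that consumes the input in order. The amplitude of
a node is known only after both its subtrees, whereas the circuit needs its rotation before them; so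
the traversal records the steps and a second loop writes them backwards. Both circuit size and
running time are in fact `O(n.choose k)`; the logarithm is only used through `1 ≤ log₂ n`. -/

namespace U1Prep

/-! ### Gate descriptions as linear maps -/

/-- The computational basis state of the first `N` bits of `z`. -/
noncomputable def ket (N : ℕ) (z : ℕ → Bool) : QVec N :=
  fun x => if x = (fun i : Fin N => z i) then 1 else 0

/-- The linear map of a gate description on `N` qubits. -/
noncomputable def GateCode.lin (N : ℕ) : GateCode → (QVec N →ₗ[ℂ] QVec N)
  | .one q U =>
    if h : q < N then
      { toFun := fun φ x => ∑ b : Bool, U (x ⟨q, h⟩) b * φ (Function.update x ⟨q, h⟩ b)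
        map_add' := by
          intro φ χ
          ext x
          simp only [Pi.add_apply, mul_add, Finset.sum_add_distrib]
        map_smul' := by
          intro r φ
          ext x
          simp only [Pi.smul_apply, smul_eq_mul, RingHom.id_apply, Finset.mul_sum]
          exact Finset.sum_congr rfl fun b _ => by ring }
    else LinearMap.id
  | .cnot c t =>
    if h : c < N ∧ t < N then
      { toFun := fun φ x =>
          φ (Function.update x ⟨t, h.2⟩ (xor (x ⟨t, h.2⟩) (x ⟨c, h.1⟩)))
        map_add' := fun _ _ => rfl
        map_smul' := fun _ _ => rfl }
    else LinearMap.id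

/-- The linear map of a list of gate descriptions, the first one being applied first. -/
noncomputable def codeRun (N : ℕ) : List GateCode → (QVec N →ₗ[ℂ] QVec N)
  | [] => LinearMap.id
  | g :: l => codeRun N l ∘ₗ g.lin N

@[simp] theorem codeRun_nil (N : ℕ) (φ : QVec N) : codeRun N [] φ = φ := rfl

@[simp] theorem codeRun_cons (N : ℕ) (g : GateCode) (l : List GateCode) (φ : QVec N) :
    codeRun N (g :: l) φ = codeRun N l (g.lin N φ) := rfl

@[simp] theorem codeRun_append (N : ℕ) (l l' : List GateCode) (φ : QVec N) :
    codeRun N (l ++ l') φ = codeRun N l' (codeRun N l φ) := by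
  induction l generalizing φ with
  | nil => rfl
  | cons g l ih => simp [ih]

theorem Gate.lin_code {N : ℕ} (g : Gate N) (φ : QVec N) : g.code.lin N φ = g.apply φ := by
  cases g with
  | one q U => simp [Gate.code, GateCode.lin, Gate.apply]
  | cnot c t h => simp [Gate.code, GateCode.lin, Gate.apply]

theorem Circuit.run_eq_codeRun {N : ℕ} (C : Circuit N) (φ : QVec N) :
    Circuit.run C φ = codeRun N (C.map Gate.code) φ := by
  induction C generalizing φ with
  | nil => rfl
  | cons g C ih =>
    rw [List.map_cons, codeRun_cons, Gate.lin_code, ← ih]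
    rfl

/-- The descriptions of gates on `N` qubits. -/
def GateCode.Valid (N : ℕ) : GateCode → Prop
  | .one q U => q < N ∧ U ∈ Matrix.unitaryGroup Bool ℂ
  | .cnot c t => c < N ∧ t < N ∧ c ≠ t

/-- This lets the whole analysis take place on the output tape; the circuit with its proofs is
recovered only at the end. -/
theorem exists_circuit {N : ℕ} (l : List GateCode) (hl : ∀ g ∈ l, g.Valid N) :
    ∃ C : Circuit N, C.map Gate.code = l := by
  induction l with
  | nil => exact ⟨[], rfl⟩
  | cons g l ih =>
    obtain ⟨C, hC⟩ := ih fun g' hg' => hl g' (List.mem_cons_of_mem _ hg')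
    have hg := hl g List.mem_cons_self
    cases g with
    | one q U => exact ⟨.one ⟨q, hg.1⟩ ⟨U, hg.2⟩ :: C, by simp [Gate.code, hC]⟩
    | cnot c t =>
      refine ⟨.cnot ⟨c, hg.1⟩ ⟨t, hg.2.1⟩ (fun h => hg.2.2 ?_) :: C, by simp [Gate.code, hC]⟩
      simpa using h

theorem lin_one_ket {N q : ℕ} (hq : q < N) (U : Matrix Bool Bool ℂ) (z : ℕ → Bool) :
    (GateCode.one q U).lin N (ket N z) =
      U false (z q) • ket N (Function.update z q false) +
        U true (z q) • ket N (Function.update z q true) := by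
  ext x
  have h₁ : ∀ b, (Function.update x ⟨q, hq⟩ b = fun i : Fin N => z i) ↔
      (∀ i : Fin N, (i : ℕ) ≠ q → x i = z i) ∧ b = z q := by
    intro b
    constructor
    · intro h
      refine ⟨fun i hi => ?_, by simpa using congrFun h ⟨q, hq⟩⟩
      have := congrFun h i
      rwa [Function.update_of_ne (fun h => hi (by rw [h]))] at this
    · rintro ⟨h, rfl⟩
      ext i
      by_cases hi : i = ⟨q, hq⟩
      · subst hi; simp
      · rw [Function.update_of_ne hi]
        exact h i fun h => hi (Fin.ext h)
  have h₂ : ∀ b, (x = fun i : Fin N => Function.update z q b i) ↔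
      (∀ i : Fin N, (i : ℕ) ≠ q → x i = z i) ∧ x ⟨q, hq⟩ = b := by
    intro b
    constructor
    · intro h
      refine ⟨fun i hi => ?_, by simp [h]⟩
      simp [h, Function.update_of_ne hi]
    · rintro ⟨h, rfl⟩
      ext i
      by_cases hi : (i : ℕ) = q
      · subst hi; simp
      · rw [Function.update_of_ne hi, h i hi]
  simp only [GateCode.lin, hq, dif_pos, LinearMap.coe_mk, AddHom.coe_mk, ket, h₁, h₂,
    Pi.add_apply, Pi.smul_apply, smul_eq_mul, Fintype.univ_bool]
  by_cases h : ∀ i : Fin N, (i : ℕ) ≠ q → x i = z i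
  · cases x ⟨q, hq⟩ <;> cases z q <;> simp
  · simp [h]

theorem lin_cnot_ket {N c t : ℕ} (hc : c < N) (ht : t < N) (hct : c ≠ t) (z : ℕ → Bool) :
    (GateCode.cnot c t).lin N (ket N z) = ket N (Function.update z t (xor (z t) (z c))) := by
  ext x
  have hct' : (⟨c, hc⟩ : Fin N) ≠ ⟨t, ht⟩ := by simpa using hct
  simp only [GateCode.lin, hc, ht, and_self, dif_pos, LinearMap.coe_mk, AddHom.coe_mk, ket]
  congr 1
  refine propext ⟨fun h => ?_, fun h => ?_⟩
  · ext i
    have hcv := congrFun h ⟨c, hc⟩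
    rw [Function.update_of_ne hct'] at hcv
    by_cases hi : (i : ℕ) = t
    · have htv := congrFun h ⟨t, ht⟩
      obtain rfl : i = ⟨t, ht⟩ := Fin.ext hi
      simp only [Function.update_self] at htv ⊢
      rw [← htv, ← hcv]
      simp
    · have hiv := congrFun h i
      rw [Function.update_of_ne (fun h => hi (by rw [h]))] at hiv
      rw [Function.update_of_ne hi, hiv]
  · subst h
    ext i
    by_cases hi : (i : ℕ) = t
    · obtain rfl : i = ⟨t, ht⟩ := Fin.ext hi
      simp [Function.update_of_ne hct]
    · rw [Function.update_of_ne (fun h => hi (by rw [h])), Function.update_of_ne hi]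

/-- The vector `u |0⟩ + v |1⟩` of the qubit `t`, the other qubits being in the state `z`. -/
noncomputable def line (N : ℕ) (z : ℕ → Bool) (t : ℕ) (u v : ℂ) : QVec N :=
  u • ket N (Function.update z t false) + v • ket N (Function.update z t true)

theorem ket_eq_line_of_false {N t : ℕ} {z : ℕ → Bool} (h : z t = false) :
    ket N z = line N z t 1 0 := by
  simp [line, ← h]

theorem ket_eq_line_of_true {N t : ℕ} {z : ℕ → Bool} (h : z t = true) :
    ket N z = line N z t 0 1 := by
  simp [line, ← h]

theorem lin_one_line {N t : ℕ} (ht : t < N) (U : Matrix Bool Bool ℂ) (z : ℕ → Bool) (u v : ℂ) :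
    (GateCode.one t U).lin N (line N z t u v) =
      line N z t (U false false * u + U false true * v) (U true false * u + U true true * v) := by
  simp only [line, map_add, map_smul, lin_one_ket ht, Function.update_self, Function.update_idem,
    smul_add, smul_smul, add_smul]
  simp only [mul_comm u, mul_comm v]
  abel

theorem lin_cnot_line {N c t : ℕ} (hc : c < N) (ht : t < N) (hct : c ≠ t) (z : ℕ → Bool)
    (u v : ℂ) :
    (GateCode.cnot c t).lin N (line N z t u v) =
      if z c then line N z t v u else line N z t u v := by
  simp only [line, map_add, map_smul, lin_cnot_ket hc ht hct, Function.update_self,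
    Function.update_idem, Function.update_of_ne hct]
  cases z c <;> simp [add_comm]

/-! ### The building blocks of the circuit -/

/-- The matrix with the given rows. -/
def mat (a b c d : ℂ) : Matrix Bool Bool ℂ :=
  Matrix.of fun i j => if i then (if j then d else c) else (if j then b else a)

@[simp] theorem mat_false_false (a b c d : ℂ) : mat a b c d false false = a := rfl
@[simp] theorem mat_false_true (a b c d : ℂ) : mat a b c d false true = b := rfl
@[simp] theorem mat_true_false (a b c d : ℂ) : mat a b c d true false = c := rfl
@[simp] theorem mat_true_true (a b c d : ℂ) : mat a b c d true true = d := rfl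

theorem mat_mem_unitaryGroup {a b c d : ℂ}
    (h₁ : a * starRingEnd ℂ a + b * starRingEnd ℂ b = 1)
    (h₂ : a * starRingEnd ℂ c + b * starRingEnd ℂ d = 0)
    (h₃ : c * starRingEnd ℂ c + d * starRingEnd ℂ d = 1) :
    mat a b c d ∈ Matrix.unitaryGroup Bool ℂ := by
  have h₄ : c * starRingEnd ℂ a + d * starRingEnd ℂ b = 0 := by
    have := congrArg (starRingEnd ℂ) h₂
    simp only [map_add, map_mul, Complex.conj_conj, map_zero] at this
    linear_combination this
  rw [Matrix.mem_unitaryGroup_iff]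
  ext i j
  rw [Matrix.mul_apply, Matrix.star_eq_conjTranspose]
  simp only [Matrix.conjTranspose_apply, Fintype.univ_bool, Finset.mem_singleton,
    Bool.true_eq_false, not_false_eq_true, Finset.sum_insert, Finset.sum_singleton]
  cases i <;> cases j <;>
    simp only [mat_false_false, mat_false_true, mat_true_false, mat_true_true, RCLike.star_def,
      Matrix.one_apply_eq, ne_eq, Bool.true_eq_false, Bool.false_eq_true, not_false_eq_true,
      Matrix.one_apply_ne]
  · linear_combination h₁
  · linear_combination h₂
  · linear_combination h₄
  · linear_combination h₃

/-- The real square root of the real part. -/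
noncomputable def csq (z : ℂ) : ℂ := ((Real.sqrt z.re : ℝ) : ℂ)

/-- `1 / √2`. -/
noncomputable def rtHalf : ℂ := csq (1 / 2)
/-- `cos (3π/8)`. -/
noncomputable def cosB : ℂ := csq ((1 - rtHalf) / 2)
/-- `sin (3π/8)`. -/
noncomputable def sinB : ℂ := csq ((1 + rtHalf) / 2)

theorem exists_rtHalf : ∃ w : ℝ, rtHalf = w ∧ 0 ≤ w ∧ w ^ 2 = 1 / 2 := by
  refine ⟨Real.sqrt (1 / 2), ?_, Real.sqrt_nonneg _, Real.sq_sqrt (by norm_num)⟩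
  norm_num [rtHalf, csq]

/-- The last two identities say that `matB * X * matB` is the Hadamard matrix, with entries `±w`;
this is all that is used about the angle. -/
theorem exists_cosB_sinB : ∃ w u v : ℝ, cosB = u ∧ sinB = v ∧ w ^ 2 = 1 / 2 ∧ u ^ 2 + v ^ 2 = 1 ∧
    v ^ 2 - u ^ 2 = w ∧ 2 * u * v = w := by
  obtain ⟨w, hw, h0, h2⟩ := exists_rtHalf
  have h1 : w ≤ 1 := by nlinarith
  have hu : ((1 - rtHalf) / 2).re = (1 - w) / 2 := by rw [hw]; simp
  have hv : ((1 + rtHalf) / 2).re = (1 + w) / 2 := by rw [hw]; simp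
  have hu2 := Real.sq_sqrt (show 0 ≤ (1 - w) / 2 by linarith)
  have hv2 := Real.sq_sqrt (show 0 ≤ (1 + w) / 2 by linarith)
  refine ⟨w, Real.sqrt ((1 - w) / 2), Real.sqrt ((1 + w) / 2), ?_, ?_, h2, ?_, ?_, ?_⟩
  · rw [cosB, csq, hu]
  · rw [sinB, csq, hv]
  · rw [hu2, hv2]; ring
  · rw [hu2, hv2]; ring
  · rw [mul_assoc, ← Real.sqrt_mul (by linarith)]
    have : (1 - w) / 2 * ((1 + w) / 2) = (w / 2) ^ 2 := by nlinarith
    rw [this, Real.sqrt_sq (by linarith)]; ring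

/-- A real reflection. -/
noncomputable def matB : Matrix Bool Bool ℂ := mat cosB sinB sinB (0 - cosB)

/-- The Pauli matrix `X`. -/
def matX : Matrix Bool Bool ℂ := mat 0 1 1 0

theorem matX_mem : matX ∈ Matrix.unitaryGroup Bool ℂ :=
  mat_mem_unitaryGroup (by simp) (by simp) (by simp)

theorem matB_mem : matB ∈ Matrix.unitaryGroup Bool ℂ := by
  obtain ⟨w, u, v, hu, hv, -, h1, -, -⟩ := exists_cosB_sinB
  have h1' : (u : ℂ) ^ 2 + (v : ℂ) ^ 2 = 1 := by exact_mod_cast h1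
  rw [matB, hu, hv]
  apply mat_mem_unitaryGroup <;> simp only [map_sub, map_zero, Complex.conj_ofReal]
  · linear_combination h1'
  · ring
  · linear_combination h1'

/-- Toggles the flag `t` if `a = 1` and `x = 0`, up to a phase when `a = x = t = 1`. -/
noncomputable def markCodes (x a t : ℕ) : List GateCode :=
  [.one t matB, .cnot x t, .one t matB, .cnot a t, .one t matB, .cnot x t, .one t matB]

/-- Write `B` for `matB`, so `B² = 1` and `BXB` is the Hadamard matrix `H`. The gates on `t` compose
to `B⁴ = 1` or `(BXB)² = 1` if `a` is 0, to `B²XB² = X` if only `a` is 1, and to `HXH = Z` if both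
are 1. The sign of `Z` is the price for using three CNOTs instead of a full Toffoli gate. -/
theorem codeRun_markCodes_line {N x a t : ℕ} (hx : x < N) (ha : a < N) (ht : t < N)
    (hxt : x ≠ t) (hat : a ≠ t) (z : ℕ → Bool) (p q : ℂ) :
    codeRun N (markCodes x a t) (line N z t p q) =
      if z a then (if z x then line N z t p (-q) else line N z t q p) else line N z t p q := by
  obtain ⟨w, u, v, hu, hv, hw, h1, h2, h3⟩ := exists_cosB_sinB
  have hw' : (w : ℂ) ^ 2 = 1 / 2 := by rw [← Complex.ofReal_pow, hw]; simp
  have h1' : (u : ℂ) ^ 2 + (v : ℂ) ^ 2 = 1 := by exact_mod_cast h1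
  have h2' : (v : ℂ) ^ 2 - (u : ℂ) ^ 2 = w := by exact_mod_cast h2
  have h3' : 2 * (u : ℂ) * v = w := by exact_mod_cast h3
  simp only [markCodes, codeRun_cons, codeRun_nil, matB, hu, hv]
  rw [lin_one_line ht, lin_cnot_line hx ht hxt]
  cases hzx : z x <;> cases hza : z a <;>
  simp only [if_true, if_false, Bool.false_eq_true, lin_one_line ht, lin_cnot_line hx ht hxt,
    lin_cnot_line ha ht hat, mat_false_false, mat_false_true, mat_true_false, mat_true_true,
    hzx, hza]
  · congr 1
    · linear_combination p * (u ^ 2 + v ^ 2 + 1) * h1'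
    · linear_combination q * (u ^ 2 + v ^ 2 + 1) * h1'
  · congr 1
    · linear_combination q * (u ^ 2 + v ^ 2 + 1) * h1'
    · linear_combination p * (u ^ 2 + v ^ 2 + 1) * h1'
  · congr 1
    · linear_combination p * (u ^ 2 + v ^ 2 + 1) * h1'
    · linear_combination q * (u ^ 2 + v ^ 2 + 1) * h1'
  · congr 1
    · linear_combination p * (2 * (v ^ 2 - u ^ 2) * h3' + 2 * w * h2' + 2 * hw') +
        q * ((v ^ 2 - u ^ 2 + w) * h2' - (2 * u * v + w) * h3')
    · linear_combination -q * (2 * (v ^ 2 - u ^ 2) * h3' + 2 * w * h2' + 2 * hw') +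
        p * ((v ^ 2 - u ^ 2 + w) * h2' - (2 * u * v + w) * h3')

/-- The hypothesis excludes the one basis case with a sign; in the circuit a raised child flag under
a raised parent flag always comes with bit 0 when a mark is applied. -/
theorem codeRun_markCodes_ket {N x a t : ℕ} (hx : x < N) (ha : a < N) (ht : t < N)
    (hxt : x ≠ t) (hat : a ≠ t) (z : ℕ → Bool) (h : z t = true → z a = true → z x = false) :
    codeRun N (markCodes x a t) (ket N z) =
      ket N (Function.update z t (xor (z t) (z a && !z x))) := by
  cases hzt : z t
  · rw [ket_eq_line_of_false hzt, codeRun_markCodes_line hx ha ht hxt hat]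
    cases z a <;> cases z x <;> simp [line]
  · rw [ket_eq_line_of_true hzt, codeRun_markCodes_line hx ha ht hxt hat]
    cases hza : z a
    · cases z x <;> simp [line]
    · simp [line, h hzt hza]

/-- The controlled reflection with control `a` and target `x`. -/
noncomputable def rotCodes (x a : ℕ) (c s : ℂ) : List GateCode :=
  [.one x (mat (c - s) (c + starRingEnd ℂ s) (c + s) (starRingEnd ℂ s - c)), .cnot a x,
    .one x (mat (c - starRingEnd ℂ s) (c + starRingEnd ℂ s) (c + s) (s - c))]

/-- For real `c` the two one-qubit gates are a unitary `V` and its adjoint. They cancel when the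
control is 0, and leave the reflection `V† X V` when it is 1. -/
theorem codeRun_rotCodes_ket_of_false {N x a : ℕ} (hx : x < N) (ha : a < N) (hax : a ≠ x) {c s : ℂ}
    (hcs : c * c + starRingEnd ℂ s * s = 1 / 2)
    {z : ℕ → Bool} (hz : z a = false) :
    codeRun N (rotCodes x a c s) (ket N z) = ket N z := by
  simp only [rotCodes, codeRun_cons, codeRun_nil]
  cases hzx : z x
  · simp only [ket_eq_line_of_false hzx, lin_one_line hx, lin_cnot_line ha hx hax, hz,
      Bool.false_eq_true, if_false, mat_false_false, mat_false_true, mat_true_false, mat_true_true]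
    congr 1
    · linear_combination 2 * hcs
    · ring
  · simp only [ket_eq_line_of_true hzx, lin_one_line hx, lin_cnot_line ha hx hax, hz,
      Bool.false_eq_true, if_false, mat_false_false, mat_false_true, mat_true_false, mat_true_true]
    congr 1
    · ring
    · linear_combination 2 * hcs

theorem codeRun_rotCodes_ket_of_true {N x a : ℕ} (hx : x < N) (ha : a < N) (hax : a ≠ x) (c s : ℂ)
    {z : ℕ → Bool} (hz : z a = true) (hzx : z x = false) :
    codeRun N (rotCodes x a c s) (ket N z) =
      (2 * (c * c - starRingEnd ℂ s * s)) • ket N z +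
        (4 * c * s) • ket N (Function.update z x true) := by
  have h : ket N z = ket N (Function.update z x false) := by rw [← hzx]; simp
  rw [h]
  change _ = line N z x _ _
  rw [← h]
  simp only [rotCodes, codeRun_cons, codeRun_nil]
  simp only [ket_eq_line_of_false hzx, lin_one_line hx, lin_cnot_line ha hx hax, hz,
      if_true, mat_false_false, mat_false_true, mat_true_false, mat_true_true]
  congr 1 <;> ring

theorem rotCodes_mem {c s : ℂ} (hc : starRingEnd ℂ c = c)
    (hcs : c * c + starRingEnd ℂ s * s = 1 / 2) :
    mat (c - s) (c + starRingEnd ℂ s) (c + s) (starRingEnd ℂ s - c) ∈ Matrix.unitaryGroup Bool ℂ ∧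
    mat (c - starRingEnd ℂ s) (c + starRingEnd ℂ s) (c + s) (s - c) ∈
      Matrix.unitaryGroup Bool ℂ := by
  constructor <;> apply mat_mem_unitaryGroup <;>
    simp only [map_sub, map_add, Complex.conj_conj, hc]
  · linear_combination 2 * hcs
  · ring
  · linear_combination 2 * hcs
  · linear_combination 2 * hcs
  · ring
  · linear_combination 2 * hcs

/-! ### The angles of the rotations -/

/-- The amplitude that the rotation with parameter `q` leaves on `|0⟩`. -/
noncomputable def rotP (q : ℂ) : ℂ := csq (1 - starRingEnd ℂ q * q)
/-- The first parameter of the controlled reflection `|0⟩ ↦ rotP q |0⟩ + q |1⟩`. -/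
noncomputable def rotC (q : ℂ) : ℂ := csq (1 + rotP q) / 2
/-- The second parameter of the controlled reflection `|0⟩ ↦ rotP q |0⟩ + q |1⟩`. -/
noncomputable def rotS (q : ℂ) : ℂ := q / (4 * rotC q)

/-- With `P = √(1 - |q|²)` the conditions force `c² = (1 + P)/4` and `|s|² = (1 - P)/4`. Since `P ≥
0`, `c` stays away from 0 and the division defining `s` is harmless. -/
theorem rot_spec {q : ℂ} (hq : ‖q‖ ≤ 1) :
    starRingEnd ℂ (rotC q) = rotC q ∧
    rotC q * rotC q + starRingEnd ℂ (rotS q) * rotS q = 1 / 2 ∧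
    2 * (rotC q * rotC q - starRingEnd ℂ (rotS q) * rotS q) = rotP q ∧
    4 * rotC q * rotS q = q := by
  have hqq : starRingEnd ℂ q * q = ((‖q‖ ^ 2 : ℝ) : ℂ) := by
    rw [mul_comm, Complex.mul_conj, Complex.normSq_eq_norm_sq]
  have hle : ‖q‖ ^ 2 ≤ 1 := by nlinarith [norm_nonneg q]
  set P := Real.sqrt (1 - ‖q‖ ^ 2) with hP
  have hP0 : 0 ≤ P := Real.sqrt_nonneg _
  have hP2 : P ^ 2 = 1 - ‖q‖ ^ 2 := Real.sq_sqrt (by linarith)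
  have hp : rotP q = (P : ℂ) := by
    rw [rotP, csq, hqq, hP]
    congr 2
  set c := Real.sqrt (1 + P) / 2 with hcd
  have hc : rotC q = (c : ℂ) := by
    rw [rotC, csq, hp]
    simp [hcd]
  have hc0 : 0 < c := by
    have : 0 < Real.sqrt (1 + P) := Real.sqrt_pos.mpr (by linarith)
    positivity
  have hc2 : c ^ 2 = (1 + P) / 4 := by
    rw [hcd, div_pow, Real.sq_sqrt (by linarith)]; norm_num
  have hs : starRingEnd ℂ (rotS q) * rotS q = (((1 - P) / 4 : ℝ) : ℂ) := by
    have : starRingEnd ℂ (rotS q) * rotS q = starRingEnd ℂ q * q / (16 * (c : ℂ) ^ 2) := by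
      simp only [rotS, hc, map_div₀, map_mul, Complex.conj_ofReal, map_ofNat]
      rw [div_mul_div_comm]
      congr 1
      ring
    rw [this, hqq, ← Complex.ofReal_pow, hc2]
    push_cast
    have h4 : (1 + (P : ℂ)) ≠ 0 := by
      have : (0 : ℝ) < 1 + P := by linarith
      exact_mod_cast this.ne'
    have hP2' : (P : ℂ) ^ 2 = 1 - (‖q‖ : ℂ) ^ 2 := by exact_mod_cast hP2
    field_simp
    linear_combination 16 * hP2'
  have hcc : rotC q * rotC q = (((1 + P) / 4 : ℝ) : ℂ) := by
    rw [hc, ← hc2]; push_cast; ring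
  refine ⟨by rw [hc, Complex.conj_ofReal], ?_, ?_, ?_⟩
  · rw [hcc, hs]; push_cast; ring
  · rw [hcc, hs, hp]; push_cast; ring
  · rw [rotS, hc]
    have : (c : ℂ) ≠ 0 := by exact_mod_cast hc0.ne'
    field_simp

/-! ### Decision trees of states -/

/-- A binary decision tree, whose leaves are amplitudes. -/
inductive Tree : Type
  | nil : Tree
  | leaf (c : ℂ) : Tree
  | node (a b : Tree) : Tree

/-- The amplitude of a leaf, and the norm of the vector of the leaves of any other tree. -/
noncomputable def Tree.amp : Tree → ℂ
  | .nil => 0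
  | .leaf c => c
  | .node a b => csq (starRingEnd ℂ a.amp * a.amp + starRingEnd ℂ b.amp * b.amp)

/-- The leaves, from left to right. -/
def Tree.leaves : Tree → List ℂ
  | .nil => []
  | .leaf c => [c]
  | .node a b => a.leaves ++ b.leaves

/-- The number of inner nodes. -/
def Tree.nodes : Tree → ℕ
  | .nil => 0
  | .leaf _ => 0
  | .node a b => a.nodes + b.nodes + 1

/-- The tree has the inner nodes of the lattice paths that leave `A` by left steps and `B` by right
steps. The steps in the direction `f` are the exceptional ones; it ends in a leaf where there are
no exceptional steps left. -/
def Tree.Shape (f : Bool) : Tree → ℕ → ℕ → Prop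
  | .nil, A, B => if f then B = 0 ∧ 0 < A else A = 0 ∧ 0 < B
  | .leaf _, A, B => if f then A = 0 ∧ 0 < B else B = 0 ∧ 0 < A
  | .node a b, A, B => 0 < A ∧ 0 < B ∧ a.Shape f (A - 1) B ∧ b.Shape f A (B - 1)

theorem Tree.amp_node (a b : Tree) :
    (Tree.node a b).amp = ((Real.sqrt (‖a.amp‖ ^ 2 + ‖b.amp‖ ^ 2) : ℝ) : ℂ) := by
  have h : ∀ z : ℂ, starRingEnd ℂ z * z = ((‖z‖ ^ 2 : ℝ) : ℂ) := fun z => by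
    rw [mul_comm, Complex.mul_conj, Complex.normSq_eq_norm_sq]
  rw [Tree.amp, csq, h, h, ← Complex.ofReal_add, Complex.ofReal_re]

theorem Tree.norm_amp_sq (t : Tree) : ‖t.amp‖ ^ 2 = (t.leaves.map fun c => ‖c‖ ^ 2).sum := by
  induction t with
  | nil => simp [Tree.amp, Tree.leaves]
  | leaf c => simp [Tree.amp, Tree.leaves]
  | node a b iha ihb =>
    rw [Tree.amp_node, Complex.norm_real, Real.norm_eq_abs, sq_abs, Real.sq_sqrt (by positivity),
      Tree.leaves, List.map_append, List.sum_append, iha, ihb]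

/-- A binary tree has one more end than inner nodes, counting `nil` as an end, and the ends obey
Pascal's rule. -/
theorem Tree.nodes_add_one {f : Bool} {t : Tree} {A B : ℕ} (h : t.Shape f A B) :
    t.nodes + 1 = (A + B).choose A := by
  induction t generalizing A B with
  | nil => cases f <;> simp_all [Tree.Shape, Tree.nodes]
  | leaf c => cases f <;> simp_all [Tree.Shape, Tree.nodes]
  | node a b iha ihb =>
    obtain ⟨hA, hB, ha, hb⟩ := h
    have h1 := iha ha
    have h2 := ihb hb
    obtain ⟨A, rfl⟩ := Nat.exists_eq_succ_of_ne_zero hA.ne'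
    obtain ⟨B, rfl⟩ := Nat.exists_eq_succ_of_ne_zero hB.ne'
    simp only [Nat.succ_eq_add_one, Nat.add_sub_cancel] at h1 h2
    rw [Tree.nodes, show A.succ + B.succ = (A + (B + 1)) + 1 by omega, Nat.choose_succ_succ, ← h1,
      show A + (B + 1) = A + 1 + B by omega, ← h2]
    omega

/-- The exceptional child. -/
def Tree.exc (f : Bool) (a b : Tree) : Tree := if f then a else b

/-- The other child. -/
def Tree.dflt (f : Bool) (a b : Tree) : Tree := if f then b else a

/-- The amplitude that the rotation at a node gives to its exceptional child. -/
noncomputable def Tree.angle (f : Bool) (a b : Tree) : ℂ :=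
  (Tree.exc f a b).amp / (Tree.node a b).amp

theorem Tree.norm_angle_le (f : Bool) (a b : Tree) : ‖Tree.angle f a b‖ ≤ 1 := by
  rw [Tree.angle, norm_div, Tree.amp_node, Complex.norm_real, Real.norm_eq_abs,
    abs_of_nonneg (Real.sqrt_nonneg _)]
  refine div_le_one_of_le₀ ?_ (Real.sqrt_nonneg _)
  refine Real.le_sqrt_of_sq_le ?_
  cases f <;> simp [Tree.exc]

theorem Tree.amp_mul_angle (f : Bool) (a b : Tree) :
    (Tree.node a b).amp * Tree.angle f a b = (Tree.exc f a b).amp := by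
  -- At a node of norm 0 the quotient takes the default value 0, which is still correct because both
  -- children vanish.
  by_cases h : (Tree.node a b).amp = 0
  · have h' := h
    rw [Tree.amp_node, Complex.ofReal_eq_zero, Real.sqrt_eq_zero (by positivity)] at h'
    have h1 : ‖a.amp‖ ^ 2 = 0 := by nlinarith [sq_nonneg ‖a.amp‖, sq_nonneg ‖b.amp‖]
    have h2 : ‖b.amp‖ ^ 2 = 0 := by nlinarith [sq_nonneg ‖a.amp‖, sq_nonneg ‖b.amp‖]
    have h1' : a.amp = 0 := by simpa using h1
    have h2' : b.amp = 0 := by simpa using h2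
    cases f <;> simp [Tree.exc, h, h1', h2']
  · rw [Tree.angle]
    field_simp

/-- `rotP` is a nonnegative real, so the rotation can match the default child only if that child
carries no phase. -/
theorem Tree.amp_mul_rotP {f : Bool} {a b : Tree} {r : ℝ} (hr : 0 ≤ r)
    (h : (Tree.dflt f a b).amp = r) :
    (Tree.node a b).amp * rotP (Tree.angle f a b) = (Tree.dflt f a b).amp := by
  have hsum : ‖a.amp‖ ^ 2 + ‖b.amp‖ ^ 2 = r ^ 2 + ‖(Tree.exc f a b).amp‖ ^ 2 := by
    have hr' : ‖(r : ℂ)‖ ^ 2 = r ^ 2 := by rw [Complex.norm_real, Real.norm_eq_abs, sq_abs]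
    cases f <;> simp only [Tree.dflt, Tree.exc, if_true, if_false, Bool.false_eq_true] at h ⊢ <;>
      rw [h, hr']
    ring
  set e := ‖(Tree.exc f a b).amp‖ with he
  have hamp : (Tree.node a b).amp = ((Real.sqrt (r ^ 2 + e ^ 2) : ℝ) : ℂ) := by
    rw [Tree.amp_node, hsum]
  set S := Real.sqrt (r ^ 2 + e ^ 2) with hS
  have hS0 : 0 ≤ S := Real.sqrt_nonneg _
  have hS2 : S ^ 2 = r ^ 2 + e ^ 2 := Real.sq_sqrt (by positivity)
  rcases hS0.eq_or_lt with h0 | hpos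
  · have hr0 : r = 0 := by nlinarith [sq_nonneg e, sq_nonneg r]
    rw [h, hamp, ← h0, hr0]; simp
  · have hq : starRingEnd ℂ (Tree.angle f a b) * Tree.angle f a b = (((e / S) ^ 2 : ℝ) : ℂ) := by
      rw [mul_comm, Complex.mul_conj, Complex.normSq_eq_norm_sq, Tree.angle, norm_div, hamp,
        Complex.norm_real, Real.norm_eq_abs, abs_of_pos hpos]
    have : (1 - (((e / S) ^ 2 : ℝ) : ℂ)).re = (r / S) ^ 2 := by
      rw [Complex.sub_re, Complex.one_re, Complex.ofReal_re]
      field_simp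
      linarith
    rw [rotP, csq, hq, this, Real.sqrt_sq (by positivity), h, hamp, ← Complex.ofReal_mul]
    congr 1
    field_simp

/-- A default step leaves the number of exceptional steps positive, so it cannot lead to a leaf; the
default child is empty or carries a norm. -/
theorem Tree.Shape.exists_amp_dflt {f : Bool} {a b : Tree} {A B : ℕ}
    (h : (Tree.node a b).Shape f A B) : ∃ r : ℝ, 0 ≤ r ∧ (Tree.dflt f a b).amp = r := by
  have key : ∀ (t : Tree) (A' B' : ℕ), t.Shape f A' B' → (if f then 0 < A' else 0 < B') →
      ∃ r : ℝ, 0 ≤ r ∧ t.amp = r := by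
    rintro (_ | c | ⟨a, b⟩) A' B' ht h0
    · exact ⟨0, le_rfl, by simp [Tree.amp]⟩
    · cases f <;> simp [Tree.Shape] at ht h0 <;> omega
    · exact ⟨_, Real.sqrt_nonneg _, Tree.amp_node a b⟩
  obtain ⟨hA, hB, ha, hb⟩ := h
  cases f
  · exact key a _ _ ha (by simpa using hB)
  · exact key b _ _ hb (by simpa using hA)

/-! ### The circuit of a decision tree -/

/-- The steps of the circuit of a decision tree. The argument is the level of the node. -/
inductive Tok : Type
  | mark (i : ℕ) : Tok
  | toggle (i : ℕ) : Tok
  | rot (i : ℕ) (c s : ℂ) : Tok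

/-- The gates of a step. The qubit `i < n` is the bit at level `i` of the tree, and the qubit `n + i`
flags the bit strings that pass through the current node at level `i`. -/
noncomputable def Tok.codes (n : ℕ) : Tok → List GateCode
  | .mark i => markCodes i (n + i) (n + i + 1)
  | .toggle i => [.cnot (n + i) (n + i + 1)]
  | .rot i c s => rotCodes i (n + i) c s

/-- The gates of a list of steps, the last one being applied first. -/
noncomputable def revCodes (n : ℕ) (l : List Tok) : List GateCode := l.reverse.flatMap (Tok.codes n)

@[simp] theorem revCodes_nil (n : ℕ) : revCodes n [] = [] := rfl

@[simp] theorem revCodes_cons (n : ℕ) (k : Tok) (l : List Tok) :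
    revCodes n (k :: l) = revCodes n l ++ k.codes n := by
  simp [revCodes]

@[simp] theorem revCodes_append (n : ℕ) (l l' : List Tok) :
    revCodes n (l ++ l') = revCodes n l' ++ revCodes n l := by
  simp [revCodes]

/-- The last steps at a node. -/
def preToks (f : Bool) (i : ℕ) : List Tok := if f then [.mark i, .toggle i] else [.mark i]

/-- The first steps at a node. -/
noncomputable def postToks (f : Bool) (i : ℕ) (q : ℂ) : List Tok :=
  if f then [.mark i, .rot i (rotC q) (rotS q)]
  else [.toggle i, .mark i, .rot i (rotC q) (rotS q)]

/-- The steps of the circuit of a tree, in reverse order. -/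
noncomputable def Tree.toks (f : Bool) : Tree → ℕ → List Tok
  | .nil, _ => []
  | .leaf _, _ => []
  | .node a b, i => preToks f i ++ (a.toks f (i + 1) ++ (.toggle i :: (b.toks f (i + 1) ++
      postToks f i (Tree.angle f a b))))

theorem Tree.length_toks (f : Bool) (t : Tree) (i : ℕ) : (t.toks f i).length = 5 * t.nodes := by
  induction t generalizing i with
  | nil => rfl
  | leaf c => rfl
  | node a b iha ihb =>
    cases f <;> simp [Tree.toks, Tree.nodes, preToks, postToks, iha, ihb] <;> omega

theorem length_revCodes_le (n : ℕ) (l : List Tok) : (revCodes n l).length ≤ 7 * l.length := by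
  induction l with
  | nil => simp
  | cons k l ih =>
    have : (k.codes n).length ≤ 7 := by
      cases k <;> simp [Tok.codes, markCodes, rotCodes]
    simp only [revCodes_cons, List.length_append, List.length_cons]
    omega

theorem Tree.valid_revCodes {f : Bool} {n : ℕ} (t : Tree) {i A B : ℕ} (h : t.Shape f A B)
    (hi : i + A + B ≤ n + 1) : ∀ g ∈ revCodes n (t.toks f i), g.Valid (n + (n + 1)) := by
  induction t generalizing i A B with
  | nil => simp [Tree.toks]
  | leaf c => simp [Tree.toks]
  | node a b iha ihb =>
    obtain ⟨hA, hB, ha, hb⟩ := h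
    have h1 := iha ha (show i + 1 + (A - 1) + B ≤ n + 1 by omega)
    have h2 := ihb hb (show i + 1 + A + (B - 1) ≤ n + 1 by omega)
    obtain ⟨hc, hcs, -, -⟩ := rot_spec (Tree.norm_angle_le f a b)
    have h3 := rotCodes_mem hc hcs
    have hm : ∀ g ∈ (Tok.mark i).codes n, g.Valid (n + (n + 1)) := by
      simp only [Tok.codes, markCodes, List.mem_cons, List.not_mem_nil, or_false]
      rintro g (rfl | rfl | rfl | rfl | rfl | rfl | rfl) <;>
        first
          | exact ⟨by omega, matB_mem⟩
          | exact ⟨by omega, by omega, by omega⟩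
    have ht : ∀ g ∈ (Tok.toggle i).codes n, g.Valid (n + (n + 1)) := by
      simp only [Tok.codes, List.mem_cons, List.not_mem_nil, or_false]
      rintro g rfl
      exact ⟨by omega, by omega, by omega⟩
    have hr : ∀ g ∈ (Tok.rot i (rotC (Tree.angle f a b)) (rotS (Tree.angle f a b))).codes n,
        g.Valid (n + (n + 1)) := by
      simp only [Tok.codes, rotCodes, List.mem_cons, List.not_mem_nil, or_false]
      rintro g (rfl | rfl | rfl)
      · exact ⟨by omega, h3.1⟩
      · exact ⟨by omega, by omega, by omega⟩
      · exact ⟨by omega, h3.2⟩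
    intro g hg
    cases f <;>
      simp only [Tree.toks, preToks, postToks, if_true, if_false, Bool.false_eq_true,
        revCodes_append, revCodes_cons, revCodes_nil, List.nil_append, List.mem_append] at hg <;>
      grind

/-! ### Correctness of the circuit of a decision tree -/

/-- The vector described by a decision tree for the bits from level `i` on, the other bits being
those of `z`. -/
noncomputable def Tree.target (f : Bool) (N : ℕ) : Tree → ℕ → (ℕ → Bool) → QVec N
  | .nil, _, _ => 0
  | .leaf c, _, z => c • ket N z
  | .node a b, i, z =>
    if f then b.target f N (i + 1) z + a.target f N (i + 1) (Function.update z i true)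
    else a.target f N (i + 1) z + b.target f N (i + 1) (Function.update z i true)

/-- The target vector is a combination of basis states obtained from `z` by raising bits at levels
from `i` on. A linear map that acts on such basis states by a relabelling commuting with these
raises therefore just relabels `z`. Applied to flag operations and, with `g = id`, to circuits of
unflagged subtrees. -/
theorem Tree.map_target {f : Bool} {N n : ℕ} (F : QVec N →ₗ[ℂ] QVec N) (P : (ℕ → Bool) → Prop)
    (g : (ℕ → Bool) → ℕ → Bool) (hF : ∀ w, P w → F (ket N w) = ket N (g w)) {i : ℕ}
    (hP : ∀ w j, i ≤ j → j < n → P w →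
      P (Function.update w j true) ∧ g (Function.update w j true) = Function.update (g w) j true)
    (t : Tree) {A B : ℕ} (h : t.Shape f A B) (hi : i + A + B ≤ n + 1) {z : ℕ → Bool} (hz : P z) :
    F (t.target f N i z) = t.target f N i (g z) := by
  induction t generalizing i A B z with
  | nil => simp [Tree.target]
  | leaf c => simp [Tree.target, hF z hz]
  | node a b iha ihb =>
    obtain ⟨hA, hB, ha, hb⟩ := h
    have hP' : ∀ w j, i + 1 ≤ j → j < n → P w → P (Function.update w j true) ∧
      g (Function.update w j true) = Function.update (g w) j true :=
      fun w j hj => hP w j (by omega)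
    have h1 := @iha (i + 1) hP' _ _ ha (by omega)
    have h2 := @ihb (i + 1) hP' _ _ hb (by omega)
    obtain ⟨hz', hg⟩ := hP z i le_rfl (by omega) hz
    cases f <;> simp [Tree.target, h1 hz, h2 hz, h1 hz', h2 hz', hg]

theorem Tree.codeRun_toggle_target {f : Bool} {n i : ℕ} (t : Tree) {A B : ℕ} (h : t.Shape f A B)
    (hi : i + 1 + A + B ≤ n + 1) (hin : i < n) {z : ℕ → Bool} (hz : z (n + i) = true) :
    codeRun (n + (n + 1)) ((Tok.toggle i).codes n) (t.target f (n + (n + 1)) (i + 1) z) =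
      t.target f (n + (n + 1)) (i + 1) (Function.update z (n + i + 1) (!z (n + i + 1))) := by
  refine t.map_target (n := n) _ (fun w => w (n + i) = true)
    (fun w => Function.update w (n + i + 1) (!w (n + i + 1))) ?_ ?_ h hi hz
  · intro w hw
    simp [Tok.codes, lin_cnot_ket (show n + i < n + (n + 1) by omega)
      (show n + i + 1 < n + (n + 1) by omega) (by omega), hw]
  · intro w j h1 h2 hw
    refine ⟨by rwa [Function.update_of_ne (by omega)], ?_⟩
    rw [Function.update_of_ne (show n + i + 1 ≠ j by omega),
      Function.update_comm (show j ≠ n + i + 1 by omega)]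

theorem Tree.codeRun_mark_target {f : Bool} {n i : ℕ} (t : Tree) {A B : ℕ} (h : t.Shape f A B)
    (hi : i + 1 + A + B ≤ n + 1) (hin : i < n) {z : ℕ → Bool} (hz : z (n + i) = true)
    (hz' : z (n + i + 1) = true → z i = false) :
    codeRun (n + (n + 1)) ((Tok.mark i).codes n) (t.target f (n + (n + 1)) (i + 1) z) =
      t.target f (n + (n + 1)) (i + 1)
        (Function.update z (n + i + 1) (xor (z (n + i + 1)) (!z i))) := by
  refine t.map_target (n := n) _
    (fun w => w (n + i) = true ∧ (w (n + i + 1) = true → w i = false))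
    (fun w => Function.update w (n + i + 1) (xor (w (n + i + 1)) (!w i))) ?_ ?_ h hi ⟨hz, hz'⟩
  · rintro w ⟨hw, hw'⟩
    simp only [Tok.codes]
    rw [codeRun_markCodes_ket (by omega) (by omega) (by omega) (by omega) (by omega) _
      (fun h _ => hw' h), hw, Bool.true_and]
  · rintro w j h1 h2 ⟨hw, hw'⟩
    rw [Function.update_of_ne (show n + i + 1 ≠ j by omega),
      Function.update_of_ne (show n + i ≠ j by omega),
      Function.update_of_ne (show i ≠ j by omega),
      Function.update_comm (show j ≠ n + i + 1 by omega)]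
    exact ⟨⟨hw, hw'⟩, rfl⟩

theorem codeRun_toggle_ket {n i : ℕ} (hin : i < n) (z : ℕ → Bool) :
    codeRun (n + (n + 1)) ((Tok.toggle i).codes n) (ket _ z) =
      ket _ (Function.update z (n + i + 1) (xor (z (n + i + 1)) (z (n + i)))) := by
  simp [Tok.codes, lin_cnot_ket (show n + i < n + (n + 1) by omega)
      (show n + i + 1 < n + (n + 1) by omega) (by omega)]

theorem codeRun_mark_ket {n i : ℕ} (hin : i < n) {z : ℕ → Bool}
    (h : z (n + i + 1) = true → z (n + i) = true → z i = false) :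
    codeRun (n + (n + 1)) ((Tok.mark i).codes n) (ket _ z) =
      ket _ (Function.update z (n + i + 1) (xor (z (n + i + 1)) (z (n + i) && !z i))) :=
  codeRun_markCodes_ket (by omega) (by omega) (by omega) (by omega) (by omega) _ h

/-- Every operation at a node is controlled by its flag, and a flag can only be raised from the flag
one level above. -/
theorem Tree.codeRun_of_false {f : Bool} {n : ℕ} (t : Tree) {i A B : ℕ} (h : t.Shape f A B)
    (hi : i + A + B ≤ n + 1) {z : ℕ → Bool} (hz : ∀ j, i ≤ j → j ≤ n → z (n + j) = false) :
    codeRun (n + (n + 1)) (revCodes n (t.toks f i)) (ket _ z) = ket _ z := by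
  induction t generalizing i A B with
  | nil => simp [Tree.toks]
  | leaf c => simp [Tree.toks]
  | node a b iha ihb =>
    obtain ⟨hA, hB, ha, hb⟩ := h
    have h1 := iha ha (show i + 1 + (A - 1) + B ≤ n + 1 by omega)
      (fun j hj => hz j (by omega))
    have h2 := ihb hb (show i + 1 + A + (B - 1) ≤ n + 1 by omega)
      (fun j hj => hz j (by omega))
    have hin : i < n := by omega
    have hzi : z (n + i) = false := hz i le_rfl (by omega)
    have hzt : z (n + i + 1) = false := hz (i + 1) (by omega) (by omega)
    have hu : Function.update z (n + i + 1) false = z := by rw [← hzt]; simp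
    obtain ⟨-, hcs, -, -⟩ := rot_spec (Tree.norm_angle_le f a b)
    have hr : codeRun (n + (n + 1))
        ((Tok.rot i (rotC (Tree.angle f a b)) (rotS (Tree.angle f a b))).codes n) (ket _ z) =
        ket _ z := codeRun_rotCodes_ket_of_false (by omega) (by omega) (by omega) hcs hzi
    have ht := codeRun_toggle_ket hin z
    have hm := codeRun_mark_ket hin (z := z) (by simp [hzt])
    rw [hzt, hzi] at ht hm
    simp only [Bool.false_and, Bool.xor_false, hu] at ht hm
    cases f <;> simp [Tree.toks, preToks, postToks, h1, h2, hr, ht, hm]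

theorem Tree.codeRun_target_of_false {f : Bool} {n : ℕ} (s : Tree) {i A B : ℕ} (h : s.Shape f A B)
    (hi : i + A + B ≤ n + 1) (t : Tree) {A' B' : ℕ} (h' : t.Shape f A' B')
    (hi' : i + A' + B' ≤ n + 1) {z : ℕ → Bool} (hz : ∀ j, i ≤ j → j ≤ n → z (n + j) = false) :
    codeRun (n + (n + 1)) (revCodes n (s.toks f i)) (t.target f (n + (n + 1)) i z) =
      t.target f (n + (n + 1)) i z := by
  refine t.map_target (n := n) _ (fun w => ∀ j, i ≤ j → j ≤ n → w (n + j) = false) id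
    (fun w hw => s.codeRun_of_false h hi hw) ?_ h' hi' hz
  intro w j h1 h2 hw
  refine ⟨fun k hk hk' => ?_, rfl⟩
  rw [Function.update_of_ne (by omega)]
  exact hw k hk hk'

/-- The factor `t.amp` is kept on the left so that no normalization is needed: subtrees of norm 0
and empty subtrees require no separate induction statement. -/
theorem Tree.codeRun_eq_target {f : Bool} {n : ℕ} (t : Tree) {i A B : ℕ} (h : t.Shape f A B)
    (hi : i + A + B ≤ n + 1) {z : ℕ → Bool} (hz : z (n + i) = true)
    (hz' : ∀ j, i + 1 ≤ j → j ≤ n → z (n + j) = false) (hx : ∀ j, i ≤ j → j < n → z j = false) :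
    t.amp • codeRun (n + (n + 1)) (revCodes n (t.toks f i)) (ket _ z) = t.target f _ i z := by
  induction t generalizing i A B z with
  | nil => simp [Tree.toks, Tree.amp, Tree.target]
  | leaf c => simp [Tree.toks, Tree.amp, Tree.target]
  | node a b iha ihb =>
    obtain ⟨r, hr0, hr⟩ := Tree.Shape.exists_amp_dflt h
    obtain ⟨hA, hB, ha, hb⟩ := h
    have hia : i + 1 + (A - 1) + B ≤ n + 1 := by omega
    have hib : i + 1 + A + (B - 1) ≤ n + 1 := by omega
    have hin : i < n := by omega
    have hzt : z (n + i + 1) = false := hz' (i + 1) (by omega) (by omega)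
    have hzi : z i = false := hx i le_rfl hin
    have hu : Function.update z (n + i + 1) false = z := by rw [← hzt]; simp
    set z' := Function.update z i true with hz'def
    have hz'i : z' i = true := by simp [hz'def]
    have hz'a : z' (n + i) = true := by rw [hz'def, Function.update_of_ne (by omega), hz]
    have hz't : ∀ j, i + 1 ≤ j → j ≤ n → z' (n + j) = false := fun j h1 h2 => by
      rw [hz'def, Function.update_of_ne (by omega), hz' j h1 h2]
    have hz'x : ∀ j, i + 1 ≤ j → j < n → z' j = false := fun j h1 h2 => by
      rw [hz'def, Function.update_of_ne (by omega), hx j (by omega) h2]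
    have hz't' : z' (n + i + 1) = false := hz't (i + 1) (by omega) (by omega)
    have hu' : Function.update z' (n + i + 1) false = z' := by rw [← hz't']; simp
    -- the flagged versions of `z` and `z'`
    have flag : ∀ w : ℕ → Bool, (∀ j, i + 1 ≤ j → j ≤ n → w (n + j) = false) →
        (∀ j, i + 1 ≤ j → j < n → w j = false) →
        Function.update w (n + i + 1) true (n + (i + 1)) = true ∧
        (∀ j, i + 1 + 1 ≤ j → j ≤ n → Function.update w (n + i + 1) true (n + j) = false) ∧
        (∀ j, i + 1 ≤ j → j < n → Function.update w (n + i + 1) true j = false) := by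
      intro w h1 h2
      refine ⟨by rw [← Nat.add_assoc]; simp, fun j h3 h4 => ?_, fun j h3 h4 => ?_⟩
      · rw [Function.update_of_ne (by omega), h1 j (by omega) h4]
      · rw [Function.update_of_ne (by omega), h2 j h3 h4]
    obtain ⟨f1, f2, f3⟩ := flag z hz' (fun j h1 => hx j (by omega))
    obtain ⟨g1, g2, g3⟩ := flag z' hz't hz'x
    set y := Function.update z (n + i + 1) true with hy
    set y' := Function.update z' (n + i + 1) true with hy'
    have hyt : y (n + i + 1) = true := by simp [hy]
    have hy't : y' (n + i + 1) = true := by simp [hy']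
    have hya : y (n + i) = true := by rw [hy, Function.update_of_ne (by omega), hz]
    have hy'a : y' (n + i) = true := by rw [hy', Function.update_of_ne (by omega), hz'a]
    have hyi : y i = false := by rw [hy, Function.update_of_ne (by omega), hzi]
    have uy : Function.update y (n + i + 1) false = z := by rw [hy]; simp [hu]
    have uy' : Function.update y' (n + i + 1) false = z' := by rw [hy']; simp [hu']
    have Bz := b.codeRun_of_false hb hib hz'
    have Bz' := b.codeRun_of_false hb hib hz't
    have ABz := a.codeRun_target_of_false ha hia b hb hib hz'
    have ABz' := a.codeRun_target_of_false ha hia b hb hib hz't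
    have Ay := iha ha hia f1 f2 f3
    have By := ihb hb hib f1 f2 f3
    have Ay' := iha ha hia g1 g2 g3
    have By' := ihb hb hib g1 g2 g3
    have Tz := codeRun_toggle_ket hin z
    have Tz' := codeRun_toggle_ket hin z'
    have Ty := codeRun_toggle_ket hin y
    have Mz := codeRun_mark_ket hin (z := z) (fun _ _ => hzi)
    have Mz' := codeRun_mark_ket hin (z := z') (by simp [hz't'])
    have TAy' := a.codeRun_toggle_target ha hia hin hy'a
    have TBy := b.codeRun_toggle_target hb hib hin hya
    have TBz := b.codeRun_toggle_target hb hib hin hz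
    have TBy' := b.codeRun_toggle_target hb hib hin hy'a
    have MAy := a.codeRun_mark_target ha hia hin hya (fun _ => hyi)
    have MBy := b.codeRun_mark_target hb hib hin hya (fun _ => hyi)
    have MAz' := a.codeRun_mark_target ha hia hin hz'a (by simp [hz't'])
    have MBz' := b.codeRun_mark_target hb hib hin hz'a (by simp [hz't'])
    simp only [hzt, hz, hzi, hz't', hz'a, hz'i, hyt, hya, hyi, hy't, Bool.not_true, Bool.not_false,
      Bool.xor_false, Bool.xor_true, Bool.true_and, hu', uy, uy', ← hy, ← hy']
      at Tz Tz' Ty Mz Mz' TAy' TBy TBz TBy' MAy MBy MAz' MBz'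
    obtain ⟨-, -, hP, hQ⟩ := rot_spec (Tree.norm_angle_le f a b)
    -- Scaling by the node's amplitude turns the ratios of the rotation into the amplitudes of the
    -- children, which are the scalars in the induction hypotheses.
    have hrot : (Tree.node a b).amp • codeRun (n + (n + 1))
        ((Tok.rot i (rotC (Tree.angle f a b)) (rotS (Tree.angle f a b))).codes n) (ket _ z) =
        (Tree.dflt f a b).amp • ket _ z + (Tree.exc f a b).amp • ket _ z' := by
      simp only [Tok.codes]
      rw [codeRun_rotCodes_ket_of_true (by omega) (by omega) (by omega) _ _ hz hzi, hP, hQ,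
        smul_add, smul_smul, smul_smul, Tree.amp_mul_angle, Tree.amp_mul_rotP hr0 hr]
    cases f
    -- In order of application: rotate; mark raises the flag of the branch with bit 0; toggle moves
    -- it to the branch with bit 1; treat `b` there; toggle it back; treat `a`; mark lowers it.
    · simp only [Tree.toks, preToks, postToks, if_false, Bool.false_eq_true, revCodes_append,
        revCodes_cons, revCodes_nil, List.nil_append, codeRun_append, ← map_smul, hrot]
      simp only [map_add, map_smul, Tree.dflt, Tree.exc, if_false, Bool.false_eq_true,
        Mz, Ty, Bz, Tz, Mz', Tz']
      simp only [← map_smul, Ay, MAy, By', TBy', ABz', MBz']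
      simp [Tree.target, hz'def]
    -- Here the stored bit 0 is the right child: rotate; mark raises its flag; treat `b`; toggle
    -- moves the flag to the other branch; treat `a`; toggle moves it back and mark lowers it.
    · simp only [Tree.toks, preToks, postToks, if_true, revCodes_append,
        revCodes_cons, revCodes_nil, List.nil_append, codeRun_append, ← map_smul, hrot]
      simp only [map_add, map_smul, Tree.dflt, Tree.exc, if_true,
        Mz, Mz', Bz', Tz']
      simp only [← map_smul, By, TBy, ABz, TBz, MBy, Ay', TAy', MAz']
      simp [Tree.target, hz'def]

/-! ### Bit strings of fixed weight in lexicographic order -/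

theorem weight_cons {n : ℕ} (b : Bool) (x : Fin n → Bool) :
    weight (Fin.cons b x : Fin (n + 1) → Bool) = (if b then 1 else 0) + weight x := by
  simp only [weight, Finset.card_filter, Fin.sum_univ_succ, Fin.cons_zero, Fin.cons_succ]

theorem weight_le {n : ℕ} (x : Fin n → Bool) : weight x ≤ n :=
  (Finset.card_le_univ _).trans_eq (Fintype.card_fin n)

/-- The bit strings of length `n` and weight `k`, by recursion on the first bit. -/
def lexList : (n k : ℕ) → List (Fin n → Bool)
  | 0, 0 => [fun i => i.elim0]
  | 0, _ + 1 => []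
  | n + 1, 0 => (lexList n 0).map (Fin.cons false)
  | n + 1, k + 1 => (lexList n (k + 1)).map (Fin.cons false) ++ (lexList n k).map (Fin.cons true)

theorem mem_map_cons {n : ℕ} {x : Fin (n + 1) → Bool} {b : Bool} {l : List (Fin n → Bool)} :
    x ∈ l.map (@Fin.cons n (fun _ => Bool) b) ↔ x 0 = b ∧ Fin.tail x ∈ l := by
  constructor
  · intro h
    obtain ⟨y, hy, rfl⟩ := List.mem_map.mp h
    exact ⟨rfl, hy⟩
  · rintro ⟨rfl, h⟩
    exact List.mem_map.mpr ⟨_, h, Fin.cons_self_tail x⟩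

theorem mem_lexList {n k : ℕ} (x : Fin n → Bool) : x ∈ lexList n k ↔ weight x = k := by
  induction n generalizing k with
  | zero =>
    have hw : weight x = 0 := by simpa using weight_le x
    cases k with
    | zero => simpa [lexList, hw] using Subsingleton.elim x _
    | succ k => simp [lexList, hw]
  | succ n ih =>
    have hw : weight x = (if x 0 then 1 else 0) + weight (Fin.tail x) := by
      rw [← weight_cons, Fin.cons_self_tail]
    cases k with
    | zero =>
      rw [lexList, mem_map_cons, ih, hw]
      cases x 0 <;> simp
    | succ k =>
      rw [lexList, List.mem_append, mem_map_cons, mem_map_cons, ih, ih, hw]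
      cases x 0 <;> (simp; try omega)

theorem cons_lex_cons {n : ℕ} {b : Bool} {x y : Fin n → Bool} (h : toLex x < toLex y) :
    toLex (Fin.cons b x : Fin (n + 1) → Bool) < toLex (Fin.cons b y : Fin (n + 1) → Bool) := by
  obtain ⟨i, h1, h2⟩ := h
  refine ⟨i.succ, fun j hj => ?_, by simpa using h2⟩
  cases j using Fin.cases with
  | zero => simp
  | succ j => simpa using h1 j (by simpa using hj)

theorem cons_false_lex_cons_true {n : ℕ} (x y : Fin n → Bool) :
    toLex (Fin.cons false x : Fin (n + 1) → Bool) <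
      toLex (Fin.cons true y : Fin (n + 1) → Bool) :=
  ⟨0, fun j hj => absurd hj (Fin.not_lt_zero j), by simp⟩

theorem pairwise_lexList (n k : ℕ) :
    (lexList n k).Pairwise fun x y => toLex x < toLex y := by
  induction n generalizing k with
  | zero => cases k <;> simp [lexList]
  | succ n ih =>
    have h : ∀ b k, ((lexList n k).map
        (@Fin.cons n (fun _ => Bool) b)).Pairwise
          fun x y => toLex x < toLex y :=
      fun b k => List.pairwise_map.mpr ((ih k).imp (cons_lex_cons (b := b)))
    cases k with
    | zero => exact h _ _
    | succ k =>
      refine List.pairwise_append.mpr ⟨h _ _, h _ _, ?_⟩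
      intro x hx y hy
      obtain ⟨x, -, rfl⟩ := List.mem_map.mp hx
      obtain ⟨y, -, rfl⟩ := List.mem_map.mp hy
      exact cons_false_lex_cons_true x y

/-- A strictly increasing list is the sorted list of its set of members. The recursive form is the
one that the leaves of the tree follow. -/
theorem weightList_eq (n k : ℕ) : weightList n k = lexList n k := by
  have hp : ((lexList n k).map toLex).Pairwise (· < ·) :=
    List.pairwise_map.mpr (pairwise_lexList n k)
  have hs : ((lexList n k).map toLex).toFinset =
      Finset.univ.filter fun x : Lex (Fin n → Bool) => weight (ofLex x) = k := by
    ext x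
    simp only [List.mem_toFinset, List.mem_map, Finset.mem_filter, Finset.mem_univ, true_and]
    constructor
    · rintro ⟨y, hy, rfl⟩
      exact (mem_lexList y).mp hy
    · intro h
      exact ⟨ofLex x, (mem_lexList _).mpr h, rfl⟩
  have hsort := (List.toFinset_sort (· ≤ ·) (hp.imp fun h => h.ne)).mpr (hp.imp fun h => h.le)
  rw [weightList, ← hs, hsort, List.map_map]
  exact List.map_id _

theorem lexList_eq_nil {n k : ℕ} (h : n < k) : lexList n k = [] :=
  List.eq_nil_iff_forall_not_mem.mpr fun x hx => by
    have := (mem_lexList x).mp hx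
    have := weight_le x
    omega

theorem lexList_zero (n : ℕ) : lexList n 0 = [fun _ => false] := by
  induction n with
  | zero => rw [lexList, List.cons.injEq]; exact ⟨Subsingleton.elim _ _, rfl⟩
  | succ n ih =>
    rw [lexList, ih, List.map_singleton]
    congr 1
    ext i
    cases i using Fin.cases <;> rfl

theorem lexList_self (n : ℕ) : lexList n n = [fun _ => true] := by
  induction n with
  | zero => rw [lexList, List.cons.injEq]; exact ⟨Subsingleton.elim _ _, rfl⟩
  | succ n ih =>
    rw [lexList, ih, lexList_eq_nil (Nat.lt_succ_self n), List.map_singleton, List.map_nil,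
      List.nil_append]
    congr 1
    ext i
    cases i using Fin.cases <;> rfl

theorem sum_weightList {M : Type*} [AddCommMonoid M] {n k : ℕ} (g : (Fin n → Bool) → M)
    (hg : ∀ x, weight x ≠ k → g x = 0) : ((weightList n k).map g).sum = ∑ x, g x := by
  rw [weightList_eq, ← List.sum_toFinset g ((pairwise_lexList n k).imp fun h => ne_of_lt h)]
  refine Finset.sum_subset (Finset.subset_univ _) fun x _ hx => hg x fun hk => hx ?_
  rwa [List.mem_toFinset, mem_lexList]

/-! ### The decision tree of a state -/

/-- The decision tree of a state of bit strings with `e` bits different from `f` and `d - 1` bits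
equal to `f`. -/
def buildTree (f : Bool) : (n d e : ℕ) → QVec n → Tree
  | _, _, 0, ψ => .leaf (ψ fun _ => f)
  | _, 0, _ + 1, _ => .nil
  | 0, _ + 1, _ + 1, _ => .nil
  | n + 1, d + 1, e + 1, ψ =>
    if f then .node (buildTree f n (d + 1) e fun x => ψ (Fin.cons (!f) x))
      (buildTree f n d (e + 1) fun x => ψ (Fin.cons f x))
    else .node (buildTree f n d (e + 1) fun x => ψ (Fin.cons f x))
      (buildTree f n (d + 1) e fun x => ψ (Fin.cons (!f) x))

theorem shape_buildTree_false {n d e : ℕ} (h : d + e = n + 1) (ψ : QVec n) :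
    (buildTree false n d e ψ).Shape false d e := by
  induction n generalizing d e with
  | zero =>
    rcases e with _ | e <;> rcases d with _ | d <;> simp [buildTree, Tree.Shape] <;> omega
  | succ n ih =>
    rcases e with _ | e
    · simp [buildTree, Tree.Shape]; omega
    · rcases d with _ | d
      · simp [buildTree, Tree.Shape]
      · simp only [buildTree, Tree.Shape, if_false, Bool.false_eq_true]
        exact ⟨by omega, by omega, ih (by omega) _, ih (by omega) _⟩

theorem shape_buildTree_true {n d e : ℕ} (h : d + e = n + 1) (ψ : QVec n) :
    (buildTree true n d e ψ).Shape true e d := by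
  induction n generalizing d e with
  | zero =>
    rcases e with _ | e <;> rcases d with _ | d <;> simp [buildTree, Tree.Shape] <;> omega
  | succ n ih =>
    rcases e with _ | e
    · simp [buildTree, Tree.Shape]; omega
    · rcases d with _ | d
      · simp [buildTree, Tree.Shape]
      · simp only [buildTree, Tree.Shape, if_true]
        exact ⟨by omega, by omega, ih (by omega) _, ih (by omega) _⟩

theorem leaves_buildTree_false {n d e : ℕ} (h : d + e = n + 1) (ψ : QVec n) :
    (buildTree false n d e ψ).leaves = (lexList n e).map ψ := by
  induction n generalizing d e with
  | zero =>
    rcases e with _ | e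
    · rw [lexList_zero]; simp [buildTree, Tree.leaves]
    · obtain rfl : d = 0 := by omega
      simp [buildTree, Tree.leaves, lexList]
  | succ n ih =>
    rcases e with _ | e
    · simp [buildTree, Tree.leaves, lexList_zero]
    · rcases d with _ | d
      · simp [buildTree, Tree.leaves, lexList_eq_nil (show n + 1 < e + 1 by omega)]
      · simp only [buildTree, Tree.leaves, if_false, Bool.false_eq_true, lexList, List.map_append,
          List.map_map]
        rw [ih (by omega), ih (by omega)]
        rfl

/-- Here ones are the default bits, so `d` is one more than the weight; `d = 0` is the dead branch
in which the surplus default bit has been used. -/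
theorem leaves_buildTree_true {n d e : ℕ} (h : d + e = n + 1) (ψ : QVec n) :
    (buildTree true n d e ψ).leaves = if d = 0 then [] else (lexList n (d - 1)).map ψ := by
  induction n generalizing d e with
  | zero =>
    rcases e with _ | e
    · obtain rfl : d = 1 := by omega
      simp [buildTree, Tree.leaves, lexList]
      congr 1
      exact Subsingleton.elim _ _
    · obtain rfl : d = 0 := by omega
      simp [buildTree, Tree.leaves]
  | succ n ih =>
    rcases e with _ | e
    · obtain rfl : d = n + 1 + 1 := by omega
      simp [buildTree, Tree.leaves, lexList_self]
    · rcases d with _ | d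
      · simp [buildTree, Tree.leaves]
      · simp only [buildTree, Tree.leaves, if_true]
        rw [ih (by omega), ih (by omega)]
        rcases d with _ | d <;> simp [lexList, Function.comp_def]

/-- The bits of `x xor f` at the levels from `i` on, and the bits of `z` elsewhere. -/
def overlay {n : ℕ} (f : Bool) (i : ℕ) (x : Fin n → Bool) (z : ℕ → Bool) : ℕ → Bool :=
  fun j => if h : i ≤ j ∧ j < i + n then xor (x ⟨j - i, by omega⟩) f else z j

theorem overlay_cons {n : ℕ} (f b : Bool) (i : ℕ) (x : Fin n → Bool) (z : ℕ → Bool) :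
    overlay f i (Fin.cons b x : Fin (n + 1) → Bool) z =
      overlay f (i + 1) x (Function.update z i (xor b f)) := by
  ext j
  simp only [overlay]
  by_cases hj : j = i
  · subst hj
    simp
  · rw [Function.update_of_ne hj]
    by_cases h : i ≤ j ∧ j < i + (n + 1)
    · rw [dif_pos h, dif_pos (by omega)]
      have : (⟨j - i, by omega⟩ : Fin (n + 1)) = Fin.succ ⟨j - (i + 1), by omega⟩ := by
        ext; simp; omega
      rw [this, Fin.cons_succ]
    · rw [dif_neg h, dif_neg (by omega)]

theorem sum_cons {n : ℕ} {M : Type*} [AddCommMonoid M] (g : (Fin (n + 1) → Bool) → M) (f : Bool) :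
    ∑ x, g x = ∑ x : Fin n → Bool, g (Fin.cons f x) + ∑ x : Fin n → Bool, g (Fin.cons (!f) x) := by
  rw [← (Fin.consEquiv fun _ : Fin (n + 1) => Bool).sum_comp, Fintype.sum_prod_type]
  cases f <;> simp [Fintype.univ_bool, Fin.consEquiv, add_comm]

theorem smul_ket_eq_sum {f : Bool} {N n : ℕ} (ψ : QVec n)
    (hψ : ∀ x, (Finset.univ.filter fun j => x j ≠ f).card ≠ 0 → ψ x = 0) (i : ℕ) {z : ℕ → Bool}
    (hz : ∀ j, i ≤ j → j < i + n → z j = false) :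
    (ψ fun _ => f) • ket N z = ∑ x, ψ x • ket N (overlay f i x z) := by
  rw [Finset.sum_eq_single fun _ => f]
  · congr 2
    ext j
    rw [overlay]
    split_ifs with hj
    · simp [hz j hj.1 hj.2]
    · rfl
  · intro x _ hx
    rw [hψ x, zero_smul]
    intro h0
    apply hx
    ext j
    by_contra hj
    have := Finset.card_eq_zero.mp h0
    exact absurd (Finset.mem_filter.mpr ⟨Finset.mem_univ j, hj⟩) (by rw [this]; simp)
  · simp

/-- The sum over strings splits by the first bit as the tree does. A leaf stands for the all-default
string alone, and in a dead branch (`d = 0`) more exceptional bits are required than there are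
positions, so `ψ = 0`. -/
theorem target_buildTree {f : Bool} {N n d e : ℕ} (h : d + e = n + 1) (ψ : QVec n)
    (hψ : ∀ x, (Finset.univ.filter fun j => x j ≠ f).card ≠ e → ψ x = 0) (i : ℕ) {z : ℕ → Bool}
    (hz : ∀ j, i ≤ j → j < i + n → z j = false) :
    (buildTree f n d e ψ).target f N i z = ∑ x, ψ x • ket N (overlay f i x z) := by
  induction n generalizing d e i z with
  | zero =>
    rcases e with _ | e
    · simpa only [buildTree, Tree.target] using smul_ket_eq_sum ψ hψ i hz
    · obtain rfl : d = 0 := by omega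
      have : ∀ x, ψ x = 0 := fun x => hψ x (by simp)
      simp [buildTree, Tree.target, this]
  | succ n ih =>
    rcases e with _ | e
    · simpa only [buildTree, Tree.target] using smul_ket_eq_sum ψ hψ i hz
    · rcases d with _ | d
      · have : ∀ x, ψ x = 0 := fun x => hψ x (by
          have := (Finset.univ.filter fun j => x j ≠ f).card_le_univ
          rw [Fintype.card_fin] at this
          omega)
        simp [buildTree, Tree.target, this]
      · have hcard : ∀ (b : Bool) (x : Fin n → Bool),
            (Finset.univ.filter fun j => (Fin.cons b x : Fin (n + 1) → Bool) j ≠ f).card =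
              (if b ≠ f then 1 else 0) + (Finset.univ.filter fun j => x j ≠ f).card := by
          intro b x
          simp only [Finset.card_filter, Fin.sum_univ_succ, Fin.cons_zero, Fin.cons_succ]
        have hz' : ∀ b j, i + 1 ≤ j → j < i + 1 + n → Function.update z i b j = false :=
          fun b j h1 h2 => by
            rw [Function.update_of_ne (by omega)]
            exact hz j (by omega) (by omega)
        have hD := ih (show d + (e + 1) = n + 1 by omega) (fun x => ψ (Fin.cons f x))
          (fun x hx => hψ _ (by rw [hcard]; simpa using hx)) (i + 1) (hz' false)
        have hE := ih (show d + 1 + e = n + 1 by omega) (fun x => ψ (Fin.cons (!f) x))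
          (fun x hx => hψ _ (by
            rw [hcard, if_pos (by cases f <;> simp)]
            omega)) (i + 1) (hz' true)
        have hzi : Function.update z i false = z := by rw [← hz i le_rfl (by omega)]; simp
        rw [hzi] at hD
        rw [sum_cons _ f]
        simp only [overlay_cons, Bool.xor_self, hzi,
          show xor (!f) f = true by cases f <;> rfl, ← hD, ← hE]
        cases f <;> simp [buildTree, Tree.target]

/-! ### The whole circuit -/

theorem lin_X_ket {N q : ℕ} (hq : q < N) (z : ℕ → Bool) :
    (GateCode.one q matX).lin N (ket N z) = ket N (Function.update z q (!z q)) := by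
  rw [lin_one_ket hq]
  cases z q <;> simp [matX]

/-- The gates of the circuit that prepares the state of the tree `t`. -/
noncomputable def fullCodes (f : Bool) (n : ℕ) (t : Tree) : List GateCode :=
  [.one n matX] ++ (revCodes n (t.toks f 0) ++ ([.one n matX] ++
    (if f then (List.range n).map fun i => .one i matX else [])))

theorem codeRun_X_range {N m : ℕ} (hm : m ≤ N) (z : ℕ → Bool) :
    codeRun N ((List.range m).map fun i => .one i matX) (ket N z) =
      ket N fun j => if j < m then !z j else z j := by
  induction m with
  | zero => simp
  | succ m ih =>
    rw [List.range_succ, List.map_append, codeRun_append, ih (by omega), List.map_singleton,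
      codeRun_cons, codeRun_nil, lin_X_ket (by omega)]
    congr 1
    ext j
    by_cases hj : j = m
    · subst hj; simp
    · rw [Function.update_of_ne hj]
      simp only [show j < m + 1 ↔ j < m by omega]

theorem tensor_zeroState (n m : ℕ) :
    tensor (zeroState n) (zeroState m) = ket (n + m) fun _ => false := by
  ext w
  simp only [tensor, zeroState, ket, mul_ite, mul_one, mul_zero]
  rw [← ite_and]
  congr 1
  refine propext ⟨fun h => ?_, fun h => by subst h; exact ⟨rfl, rfl⟩⟩
  ext i
  cases i using Fin.addCases with
  | left i => exact congrFun h.2 i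
  | right i => exact congrFun h.1 i

theorem tensor_eq_sum {n m : ℕ} (ψ : QVec n) :
    tensor ψ (zeroState m) = ∑ x, ψ x • ket (n + m) (overlay false 0 x fun _ => false) := by
  ext w
  have h : ∀ x : Fin n → Bool, (w = fun i : Fin (n + m) => overlay false 0 x (fun _ => false) i) ↔
      x = (fun i => w (Fin.castAdd m i)) ∧ (fun j => w (Fin.natAdd n j)) = fun _ => false := by
    intro x
    constructor
    · intro h
      subst h
      constructor
      · ext i; simp [overlay]
      · ext i; simp [overlay]
    · rintro ⟨rfl, h⟩
      ext i
      cases i using Fin.addCases with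
      | left i => simp [overlay]
      | right i => simpa [overlay] using congrFun h i
  rw [Finset.sum_apply]
  simp only [Pi.smul_apply, ket, h, smul_eq_mul, tensor, zeroState, mul_ite, mul_one, mul_zero,
    ite_and]
  simp

/-- The first `X` on qubit `n` raises the root flag and the second lowers it; the final layer of `X`
gates undoes the complementation of the bits when `f` is true. -/
theorem codeRun_fullCodes {f : Bool} {n d e : ℕ} (h : d + e = n + 1) (ψ : QVec n)
    (hψ : ∀ x, (Finset.univ.filter fun j => x j ≠ f).card ≠ e → ψ x = 0)
    (hamp : (buildTree f n d e ψ).amp = 1) :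
    codeRun (n + (n + 1)) (fullCodes f n (buildTree f n d e ψ))
      (tensor (zeroState n) (zeroState (n + 1))) = tensor ψ (zeroState (n + 1)) := by
  -- `Shape` counts left and right steps, `buildTree` default and exceptional ones; the two orders
  -- agree for `f = false` and are swapped for `f = true`.
  obtain ⟨A, B, hAB, hs⟩ : ∃ A B, A + B = n + 1 ∧ (buildTree f n d e ψ).Shape f A B := by
    cases f
    · exact ⟨d, e, h, shape_buildTree_false h ψ⟩
    · exact ⟨e, d, by omega, shape_buildTree_true h ψ⟩
  have hz : ∀ j, j ≠ n → Function.update (fun _ : ℕ => false) n true j = false :=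
    fun j hj => by rw [Function.update_of_ne hj]
  have h1 := (buildTree f n d e ψ).codeRun_eq_target (i := 0) (n := n) hs (by omega)
    (z := Function.update (fun _ => false) n true) (by simp) (fun j h1 h2 => hz _ (by omega))
    (fun j h1 h2 => hz _ (by omega))
  rw [hamp, one_smul, target_buildTree h ψ hψ 0 (fun j h1 h2 => hz _ (by omega))] at h1
  have hov : ∀ x : Fin n → Bool,
      (!overlay f 0 x (Function.update (fun _ => false) n true) n) = false ∧
      Function.update (overlay f 0 x (Function.update (fun _ => false) n true)) n false =
        overlay f 0 x fun _ => false := by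
    intro x
    constructor
    · simp [overlay]
    · ext j
      by_cases hj : j = n
      · subst hj; simp [overlay]
      · rw [Function.update_of_ne hj, overlay, overlay, hz j hj]
  rw [tensor_zeroState, tensor_eq_sum, fullCodes, codeRun_append, codeRun_cons, codeRun_nil,
    lin_X_ket (by omega), Bool.not_false, codeRun_append, h1, codeRun_append, codeRun_cons,
    codeRun_nil, map_sum, map_sum]
  refine Finset.sum_congr rfl fun x _ => ?_
  rw [map_smul, map_smul, lin_X_ket (by omega), (hov x).1, (hov x).2]
  congr 1
  cases f
  · simp
  · rw [if_pos rfl, codeRun_X_range (by omega)]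
    congr 1
    ext j
    by_cases hj : j < n <;> simp [overlay, hj]

theorem valid_fullCodes {f : Bool} {n A B : ℕ} {t : Tree} (h : t.Shape f A B)
    (hAB : A + B = n + 1) : ∀ g ∈ fullCodes f n t, g.Valid (n + (n + 1)) := by
  intro g hg
  simp only [fullCodes, List.mem_append, List.mem_singleton] at hg
  rcases hg with rfl | hg | rfl | hg
  · exact ⟨by omega, matX_mem⟩
  · exact t.valid_revCodes h (by omega) g hg
  · exact ⟨by omega, matX_mem⟩
  · cases f
    · simp at hg
    · simp only [if_true, List.mem_map, List.mem_range] at hg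
      obtain ⟨i, hi, rfl⟩ := hg
      exact ⟨by omega, matX_mem⟩

/-- Five steps per inner node with at most seven gates each, two gates for the root flag, and at
most `n` final flips. -/
theorem length_fullCodes_le (f : Bool) (n : ℕ) (t : Tree) :
    (fullCodes f n t).length ≤ 35 * t.nodes + n + 2 := by
  have h1 := length_revCodes_le n (t.toks f 0)
  rw [t.length_toks] at h1
  have h2 : (if f then (List.range n).map fun i => GateCode.one i matX else []).length ≤ n := by
    cases f <;> simp
  simp only [fullCodes, List.length_append, List.length_singleton]
  omega

theorem exists_tree {n k : ℕ} (hk : 1 ≤ k) (hkn : k < n) {ψ : QVec n} (hψ : IsU1State k ψ)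
    (f : Bool) : ∃ t : Tree,
      (if f then t.Shape f (n - k) (k + 1) else t.Shape f (n - k + 1) k) ∧
      t.leaves = (weightList n k).map ψ ∧
      codeRun (n + (n + 1)) (fullCodes f n t) (tensor (zeroState n) (zeroState (n + 1))) =
        tensor ψ (zeroState (n + 1)) := by
  -- With exceptional bits present the root is an inner node, so its amplitude is a nonnegative
  -- real; normalization makes it exactly 1, leaving no global phase.
  have hnode : ∀ d e, 1 ≤ d → 1 ≤ e → (buildTree f n d e ψ).leaves = (weightList n k).map ψ →
      (buildTree f n d e ψ).amp = 1 := by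
    intro d e hd he hl
    have hn : ‖(buildTree f n d e ψ).amp‖ ^ 2 = 1 := by
      rw [Tree.norm_amp_sq, hl, List.map_map, ← hψ.normalized]
      exact sum_weightList (fun x => ‖ψ x‖ ^ 2) fun x hx => by simp [hψ.support x hx]
    have hr : ∃ r : ℝ, 0 ≤ r ∧ (buildTree f n d e ψ).amp = r := by
      obtain ⟨d, rfl⟩ := Nat.exists_eq_succ_of_ne_zero (by omega : d ≠ 0)
      obtain ⟨e, rfl⟩ := Nat.exists_eq_succ_of_ne_zero (by omega : e ≠ 0)
      obtain ⟨n, rfl⟩ := Nat.exists_eq_succ_of_ne_zero (by omega : n ≠ 0)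
      cases f <;> exact ⟨_, Real.sqrt_nonneg _, Tree.amp_node _ _⟩
    obtain ⟨r, hr0, hr⟩ := hr
    rw [hr, Complex.norm_real, Real.norm_eq_abs, sq_abs] at hn
    rw [hr, show r = 1 by nlinarith, Complex.ofReal_one]
  cases f
  · have hl := leaves_buildTree_false (show n - k + 1 + k = n + 1 by omega) ψ
    rw [← weightList_eq] at hl
    refine ⟨_, shape_buildTree_false (show n - k + 1 + k = n + 1 by omega) ψ, hl,
      codeRun_fullCodes (by omega) ψ (fun x hx => hψ.support x ?_)
        (hnode _ _ (by omega) hk hl)⟩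
    simpa [weight] using hx
  · have hl := leaves_buildTree_true (show k + 1 + (n - k) = n + 1 by omega) ψ
    rw [if_neg (by omega), Nat.add_sub_cancel, ← weightList_eq] at hl
    refine ⟨_, shape_buildTree_true (show k + 1 + (n - k) = n + 1 by omega) ψ, hl,
      codeRun_fullCodes (by omega) ψ (fun x hx => hψ.support x ?_)
        (hnode _ _ (by omega) (by omega) hl)⟩
    have := Finset.card_filter_add_card_filter_not (s := Finset.univ) fun j => x j = true
    rw [Finset.card_univ, Fintype.card_fin] at this
    simp only [weight]
    simp only [ne_eq] at hx
    omega

/-! ### Binomial estimates for the number of nodes -/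

theorem choose_succ_le {n e : ℕ} (he : 1 ≤ e) (hen : 2 * e ≤ n) :
    (n + 1).choose e ≤ 2 * n.choose e := by
  obtain ⟨e, rfl⟩ := Nat.exists_eq_succ_of_ne_zero (by omega : e ≠ 0)
  rw [Nat.succ_eq_add_one, Nat.choose_succ_succ]
  have := Nat.choose_le_succ_of_lt_half_left (show e < n / 2 by omega)
  simp only [Nat.succ_eq_add_one] at this ⊢
  omega

/-- Absorbs the costs linear in `n`: the final flips and the computation of `n - k`. -/
theorem le_choose {n k : ℕ} (hk : 1 ≤ k) (hkn : k < n) : n ≤ n.choose k := by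
  induction n generalizing k with
  | zero => omega
  | succ n ih =>
    obtain ⟨k, rfl⟩ := Nat.exists_eq_succ_of_ne_zero (by omega : k ≠ 0)
    rw [Nat.succ_eq_add_one, Nat.choose_succ_succ]
    rcases (show k + 1 ≤ n by omega).eq_or_lt with rfl | h
    · simp
    · have h1 := ih (by omega) h
      have h2 : 0 < n.choose k := Nat.choose_pos (by omega)
      simp only [Nat.succ_eq_add_one]
      omega

/-- The number `e` of exceptional bits is at most `n / 2`, where the binomial coefficients still
increase, so Pascal's rule at most doubles `n.choose e`. With the majority as exceptional bit this
would fail: one zero and `n - 1` exceptional ones give quadratically many nodes. -/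
theorem nodes_le {n k : ℕ} (hk : 1 ≤ k) (hkn : k < n) {t : Tree} {f : Bool}
    (hf : f = true ↔ n - k < k)
    (h : if f then t.Shape f (n - k) (k + 1) else t.Shape f (n - k + 1) k) :
    t.nodes + 1 ≤ 2 * n.choose k := by
  cases f
  · have hf' : ¬ n - k < k := fun h => by simpa using hf.mpr h
    rw [Tree.nodes_add_one h, show n - k + 1 + k = n + 1 by omega,
      ← Nat.choose_symm (by omega), show n + 1 - (n - k + 1) = k by omega]
    exact choose_succ_le hk (by omega)
  · have hf' : n - k < k := hf.mp rfl
    rw [Tree.nodes_add_one h, show n - k + (k + 1) = n + 1 by omega,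
      ← Nat.choose_symm (show k ≤ n by omega)]
    exact choose_succ_le (by omega) (by omega)

/-! ### Execution of programs -/

/-- Write an entry of a natural-number array. -/
def Store.setArr (σ : Store) (a i v : ℕ) : Store :=
  { σ with arr := Function.update σ.arr a (Function.update (σ.arr a) i v) }

/-- Write an entry of a complex array. -/
noncomputable def Store.setCarr (σ : Store) (a i : ℕ) (z : ℂ) : Store :=
  { σ with carr := Function.update σ.carr a (Function.update (σ.carr a) i z) }

/-- Write to the output tape. -/
def Store.emit (σ : Store) (g : GateCode) : Store := { σ with out := σ.out ++ [g] }

section Fields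

variable (σ : Store) (r s a b i v : ℕ) (z : ℂ) (g : GateCode)

theorem Store.reg_setReg : (σ.setReg r v).reg s = if s = r then v else σ.reg s := by
  simp [Store.setReg, Function.update_apply]
theorem Store.arr_setReg : (σ.setReg r v).arr = σ.arr := rfl
theorem Store.creg_setReg : (σ.setReg r v).creg = σ.creg := rfl
theorem Store.carr_setReg : (σ.setReg r v).carr = σ.carr := rfl
theorem Store.out_setReg : (σ.setReg r v).out = σ.out := rfl

theorem Store.reg_setCreg : (σ.setCreg r z).reg = σ.reg := rfl
theorem Store.arr_setCreg : (σ.setCreg r z).arr = σ.arr := rfl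
theorem Store.creg_setCreg : (σ.setCreg r z).creg s = if s = r then z else σ.creg s := by
  simp [Store.setCreg, Function.update_apply]
theorem Store.carr_setCreg : (σ.setCreg r z).carr = σ.carr := rfl
theorem Store.out_setCreg : (σ.setCreg r z).out = σ.out := rfl

theorem Store.reg_setArr : (σ.setArr a i v).reg = σ.reg := rfl
theorem Store.arr_setArr : (σ.setArr a i v).arr b =
    if b = a then Function.update (σ.arr a) i v else σ.arr b := by
  simp [Store.setArr, Function.update_apply]
theorem Store.creg_setArr : (σ.setArr a i v).creg = σ.creg := rfl
theorem Store.carr_setArr : (σ.setArr a i v).carr = σ.carr := rfl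
theorem Store.out_setArr : (σ.setArr a i v).out = σ.out := rfl

theorem Store.reg_setCarr : (σ.setCarr a i z).reg = σ.reg := rfl
theorem Store.arr_setCarr : (σ.setCarr a i z).arr = σ.arr := rfl
theorem Store.creg_setCarr : (σ.setCarr a i z).creg = σ.creg := rfl
theorem Store.carr_setCarr : (σ.setCarr a i z).carr b =
    if b = a then Function.update (σ.carr a) i z else σ.carr b := by
  simp [Store.setCarr, Function.update_apply]
theorem Store.out_setCarr : (σ.setCarr a i z).out = σ.out := rfl

theorem Store.reg_emit : (σ.emit g).reg = σ.reg := rfl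
theorem Store.arr_emit : (σ.emit g).arr = σ.arr := rfl
theorem Store.creg_emit : (σ.emit g).creg = σ.creg := rfl
theorem Store.carr_emit : (σ.emit g).carr = σ.carr := rfl
theorem Store.out_emit : (σ.emit g).out = σ.out ++ [g] := rfl

end Fields

section Instructions

variable (σ : Store) (r s t a i v c : ℕ) (p q : ℚ)

theorem exec_const : (Instr.const r v).exec σ = σ.setReg r v := rfl
theorem exec_addConst : (Instr.addConst r s v).exec σ = σ.setReg r (σ.reg s + v) := rfl
theorem exec_subConst : (Instr.subConst r s v).exec σ = σ.setReg r (σ.reg s - v) := rfl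
theorem exec_load : (Instr.load r a i).exec σ = σ.setReg r (σ.arr a (σ.reg i)) := rfl
theorem exec_store : (Instr.store a i r).exec σ = σ.setArr a (σ.reg i) (σ.reg r) := rfl
theorem exec_cconst : (Instr.cconst r p q).exec σ =
    σ.setCreg r ((p : ℂ) + (q : ℂ) * Complex.I) := rfl
theorem exec_cadd : (Instr.cadd r s t).exec σ = σ.setCreg r (σ.creg s + σ.creg t) := rfl
theorem exec_csub : (Instr.csub r s t).exec σ = σ.setCreg r (σ.creg s - σ.creg t) := rfl
theorem exec_cmul : (Instr.cmul r s t).exec σ = σ.setCreg r (σ.creg s * σ.creg t) := rfl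
theorem exec_cdiv : (Instr.cdiv r s t).exec σ = σ.setCreg r (σ.creg s / σ.creg t) := rfl
theorem exec_cconj : (Instr.cconj r s).exec σ = σ.setCreg r (starRingEnd ℂ (σ.creg s)) := rfl
theorem exec_csqrt : (Instr.csqrt r s).exec σ = σ.setCreg r (csq (σ.creg s)) := rfl
theorem exec_cload : (Instr.cload r a i).exec σ = σ.setCreg r (σ.carr a (σ.reg i)) := rfl
theorem exec_cstore : (Instr.cstore a i r).exec σ = σ.setCarr a (σ.reg i) (σ.creg r) := rfl
theorem exec_emitCnot : (Instr.emitCnot c t).exec σ =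
    σ.emit (.cnot (σ.reg c) (σ.reg t)) := rfl
theorem exec_emitOne (u₀₀ u₀₁ u₁₀ u₁₁ : ℕ) : (Instr.emitOne r u₀₀ u₀₁ u₁₀ u₁₁).exec σ =
    σ.emit (.one (σ.reg r) (mat (σ.creg u₀₀) (σ.creg u₀₁) (σ.creg u₁₀) (σ.creg u₁₁))) := by
  simp only [Instr.exec, Store.emit, mat]
  congr 5
  funext i j
  cases i <;> cases j <;> rfl

end Instructions

/-- The memory after a sequence of instructions. -/
noncomputable def runL : List Instr → Store → Store
  | [], σ => σ
  | i :: l, σ => runL l (i.exec σ)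

theorem runL_nil (σ : Store) : runL [] σ = σ := rfl
theorem runL_cons (i : Instr) (l : List Instr) (σ : Store) :
    runL (i :: l) σ = runL l (i.exec σ) := rfl

/-- The program that executes a sequence of instructions. -/
def straight : List Instr → Prog
  | [] => .instr .skip
  | i :: l => .seq (.instr i) (straight l)

theorem exec_straight (l : List Instr) (σ : Store) :
    Exec (straight l) σ (l.length + 1) (runL l σ) := by
  induction l generalizing σ with
  | nil => exact Exec.instr .skip σ
  | cons i l ih =>
    rw [List.length_cons, Nat.add_comm l.length, Nat.add_assoc]
    exact Exec.seq (Exec.instr i σ) (ih _)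

/-- `Steps b p σ t τ`: some rounds of the loop `loop b p` lead from `σ` to `τ` in `t` steps. -/
inductive Steps (b : Test) (p : Prog) : Store → ℕ → Store → Prop
  | refl (σ : Store) : Steps b p σ 0 σ
  | step {σ τ υ : Store} {t u : ℕ} (hb : b.holds σ) (h₁ : Exec p σ t τ) (h₂ : Steps b p τ u υ) :
      Steps b p σ (t + u + 1) υ

theorem Steps.trans {b : Test} {p : Prog} {σ τ υ : Store} {t u : ℕ} (h₁ : Steps b p σ t τ)
    (h₂ : Steps b p τ u υ) : Steps b p σ (t + u) υ := by
  induction h₁ with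
  | refl => simpa using h₂
  | @step σ τ _ t v hb h _ ih =>
    rw [show t + v + 1 + u = t + (v + u) + 1 by omega]
    exact .step hb h (ih h₂)

theorem Steps.single {b : Test} {p : Prog} {σ τ : Store} {t : ℕ} (hb : b.holds σ)
    (h : Exec p σ t τ) : Steps b p σ (t + 1) τ :=
  .step hb h (.refl τ)

theorem Steps.exec_loop {b : Test} {p : Prog} {σ τ : Store} {t : ℕ} (h : Steps b p σ t τ)
    (hb : ¬ b.holds τ) : Exec (.loop b p) σ (t + 1) τ := by
  induction h with
  | refl => exact .loopDone hb
  | @step σ τ _ t v hb' h _ ih =>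
    rw [show t + v + 1 + 1 = t + (v + 1) + 1 by omega]
    exact .loopStep hb' h (ih hb)

/-! ### The traversal of the tree

Registers: 0 holds `n`, 2 and 3 the numbers of steps left, 4 and 5 the level `i` as `i + 1` and
`n + i`, 6 the position in the input, 7 the number of recorded steps, 8 is `0` on the way down and
`1` on the way up, 9 is `0`. The complex register 0 holds the amplitude of the subtree just left.
Arrays: 0 holds for every level the child that is being visited, 1, 2 and 3 the recorded steps.
Complex arrays: 0 is the input, 1 holds for every level the amplitude of the first child, 2 and 3
the parameters of the recorded steps. -/

/-- The step `k` is recorded at the position `j`. -/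
def TokAt (n : ℕ) (a₁ a₂ a₃ : ℕ → ℕ) (c₂ c₃ : ℕ → ℂ) (j : ℕ) : Tok → Prop
  | .mark i => a₁ j = 0 ∧ a₂ j = i + 1 ∧ a₃ j = n + i
  | .toggle i => a₁ j = 1 ∧ a₂ j = i + 1 ∧ a₃ j = n + i
  | .rot i c s => a₁ j = 2 ∧ a₂ j = i + 1 ∧ a₃ j = n + i ∧ c₂ j = c ∧ c₃ j = s

/-- The steps `L` are recorded. -/
def Enc (n : ℕ) (a₁ a₂ a₃ : ℕ → ℕ) (c₂ c₃ : ℕ → ℂ) (L : List Tok) : Prop :=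
  ∀ j (h : j < L.length), TokAt n a₁ a₂ a₃ c₂ c₃ j L[j]

theorem Enc.snoc {n : ℕ} {a₁ a₂ a₃ a₁' a₂' a₃' : ℕ → ℕ} {c₂ c₃ c₂' c₃' : ℕ → ℂ} {L : List Tok}
    (h : Enc n a₁ a₂ a₃ c₂ c₃ L)
    (h' : ∀ j < L.length, a₁' j = a₁ j ∧ a₂' j = a₂ j ∧ a₃' j = a₃ j ∧ c₂' j = c₂ j ∧ c₃' j = c₃ j)
    {k : Tok} (hk : TokAt n a₁' a₂' a₃' c₂' c₃' L.length k) :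
    Enc n a₁' a₂' a₃' c₂' c₃' (L ++ [k]) := by
  intro j hj
  rw [List.length_append, List.length_singleton] at hj
  rcases (show j ≤ L.length by omega).eq_or_lt with rfl | hj'
  · simpa using hk
  · rw [List.getElem_append_left hj']
    obtain ⟨h1, h2, h3, h4, h5⟩ := h' j hj'
    have := h j hj'
    cases hL : L[j] <;> rw [hL] at this <;> simpa only [TokAt, h1, h2, h3, h4, h5] using this

section EncPush

variable {n i : ℕ} {a₁ a₂ a₃ : ℕ → ℕ} {c₂ c₃ : ℕ → ℂ} {L : List Tok}

theorem Enc.mark (h : Enc n a₁ a₂ a₃ c₂ c₃ L) {m : ℕ} (hm : m = L.length) :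
    Enc n (Function.update a₁ m 0) (Function.update a₂ m (i + 1)) (Function.update a₃ m (n + i))
      c₂ c₃ (L ++ [.mark i]) := by
  subst hm
  refine h.snoc (fun j hj => ?_) (by simp [TokAt])
  simp [Function.update_of_ne hj.ne]

theorem Enc.toggle (h : Enc n a₁ a₂ a₃ c₂ c₃ L) {m : ℕ} (hm : m = L.length) :
    Enc n (Function.update a₁ m 1) (Function.update a₂ m (i + 1)) (Function.update a₃ m (n + i))
      c₂ c₃ (L ++ [.toggle i]) := by
  subst hm
  refine h.snoc (fun j hj => ?_) (by simp [TokAt])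
  simp [Function.update_of_ne hj.ne]

theorem Enc.rot (h : Enc n a₁ a₂ a₃ c₂ c₃ L) {m : ℕ} (hm : m = L.length) (c s : ℂ) :
    Enc n (Function.update a₁ m 2) (Function.update a₂ m (i + 1)) (Function.update a₃ m (n + i))
      (Function.update c₂ m c) (Function.update c₃ m s) (L ++ [.rot i c s]) := by
  subst hm
  refine h.snoc (fun j hj => ?_) (by simp [TokAt])
  simp [Function.update_of_ne hj.ne]

end EncPush

/-- Record a step of the kind `ty` at the current level. -/
def pushCode (ty : ℕ) : List Instr :=
  [.const 10 ty, .store 1 7 10, .store 2 7 4, .store 3 7 5, .addConst 7 7 1]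

/-- Read an amplitude. -/
def leafCode : List Instr := [.cload 0 0 6, .addConst 6 6 1, .const 8 1]

/-- An empty subtree. -/
def nilCode : List Instr := [.cconst 0 0 0, .const 8 1]

/-- Go to the left child. -/
def downCode (f : Bool) : List Instr :=
  (if f then pushCode 0 ++ pushCode 1 else pushCode 0) ++
    [.store 0 4 9, .subConst 2 2 1, .addConst 4 4 1, .addConst 5 5 1]

/-- Go to the parent. -/
def upCode : List Instr := [.subConst 4 4 1, .subConst 5 5 1, .load 11 0 4]

/-- Go from the left child to the right child. -/
def midCode : List Instr :=
  [.addConst 2 2 1, .subConst 3 3 1, .cstore 1 4 0] ++ (pushCode 1 ++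
    [.const 10 1, .store 0 4 10, .addConst 4 4 1, .addConst 5 5 1, .const 8 0])

/-- Compute the amplitude of a node and the parameters of its rotation. -/
def rotCode (f : Bool) : List Instr :=
  [.addConst 3 3 1, .cload 1 1 4, .cconj 2 0, .cmul 2 2 0, .cconj 3 1, .cmul 3 3 1, .cadd 2 3 2,
    .csqrt 2 2, .cdiv 3 (if f then 1 else 0) 2, .cconj 4 3, .cmul 4 4 3, .cconst 5 1 0,
    .csub 4 5 4, .csqrt 4 4, .cadd 4 5 4, .csqrt 4 4, .cconst 5 2 0, .cdiv 4 4 5, .cconst 5 4 0,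
    .cmul 5 5 4, .cdiv 5 3 5, .cconst 6 0 0, .cadd 0 2 6]

/-- Leave a node. -/
def exitCode (f : Bool) : List Instr :=
  rotCode f ++ ((if f then pushCode 0 else pushCode 1 ++ pushCode 0) ++
    ([.cstore 2 7 4, .cstore 3 7 5] ++ pushCode 2))

/-- One round of the traversal. -/
def dfsBody (f : Bool) : Prog :=
  .ite (.eq 8 9)
    (.ite (.eq 2 9) (straight (if f then leafCode else nilCode))
      (.ite (.eq 3 9) (straight (if f then nilCode else leafCode)) (straight (downCode f))))
    (.seq (straight upCode) (.ite (.eq 11 9) (straight midCode) (straight (exitCode f))))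

/-- The state of the machine during the traversal. -/
structure At (n : ℕ) (L : List Tok) (i A B idx mode : ℕ) (σ : Store) : Prop where
  r2 : σ.reg 2 = A
  r3 : σ.reg 3 = B
  r4 : σ.reg 4 = i + 1
  r5 : σ.reg 5 = n + i
  r6 : σ.reg 6 = idx
  r7 : σ.reg 7 = L.length
  r8 : σ.reg 8 = mode
  r9 : σ.reg 9 = 0
  enc : Enc n (σ.arr 1) (σ.arr 2) (σ.arr 3) (σ.carr 2) (σ.carr 3) L

/-- What the traversal of a subtree at level `i` leaves unchanged. -/
structure Frame (i : ℕ) (σ τ : Store) : Prop where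
  r0 : τ.reg 0 = σ.reg 0
  out : τ.out = σ.out
  inp : τ.carr 0 = σ.carr 0
  stage : ∀ j ≤ i, τ.arr 0 j = σ.arr 0 j
  saved : ∀ j ≤ i, τ.carr 1 j = σ.carr 1 j

theorem Frame.trans {i : ℕ} {σ τ υ : Store} (h : Frame i σ τ) (h' : Frame i τ υ) : Frame i σ υ where
  r0 := h'.r0.trans h.r0
  out := h'.out.trans h.out
  inp := h'.inp.trans h.inp
  stage j hj := (h'.stage j hj).trans (h.stage j hj)
  saved j hj := (h'.saved j hj).trans (h.saved j hj)

theorem Frame.mono {i i' : ℕ} {σ τ : Store} (h : Frame i' σ τ) (hi : i ≤ i') : Frame i σ τ where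
  r0 := h.r0
  out := h.out
  inp := h.inp
  stage j hj := h.stage j (hj.trans hi)
  saved j hj := h.saved j (hj.trans hi)

attribute [local simp] Store.reg_setReg Store.arr_setReg Store.creg_setReg Store.carr_setReg
  Store.out_setReg Store.reg_setCreg Store.arr_setCreg Store.creg_setCreg Store.carr_setCreg
  Store.out_setCreg Store.reg_setArr Store.arr_setArr Store.creg_setArr Store.carr_setArr
  Store.out_setArr Store.reg_setCarr Store.arr_setCarr Store.creg_setCarr Store.carr_setCarr
  Store.out_setCarr Store.reg_emit Store.arr_emit Store.creg_emit Store.carr_emit Store.out_emit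
  exec_const exec_addConst exec_subConst exec_load exec_store exec_cconst exec_cadd exec_csub
  exec_cmul exec_cdiv exec_cconj exec_csqrt exec_cload exec_cstore exec_emitCnot exec_emitOne
  runL_nil runL_cons

section Rounds

variable {f : Bool} {n : ℕ} {L : List Tok} {i A B idx : ℕ} {σ : Store}

theorem runL_leafCode (h : At n L i A B idx 0 σ) :
    At n L i A B (idx + 1) 1 (runL leafCode σ) ∧ (runL leafCode σ).creg 0 = σ.carr 0 idx ∧
      Frame i σ (runL leafCode σ) := by
  obtain ⟨r2, r3, r4, r5, r6, r7, r8, r9, henc⟩ := h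
  refine ⟨⟨?_, ?_, ?_, ?_, ?_, ?_, ?_, ?_, ?_⟩, ?_, ⟨?_, ?_, ?_, ?_, ?_⟩⟩ <;>
    simp [leafCode, *]

theorem runL_nilCode (h : At n L i A B idx 0 σ) :
    At n L i A B idx 1 (runL nilCode σ) ∧ (runL nilCode σ).creg 0 = 0 ∧
      Frame i σ (runL nilCode σ) := by
  obtain ⟨r2, r3, r4, r5, r6, r7, r8, r9, henc⟩ := h
  refine ⟨⟨?_, ?_, ?_, ?_, ?_, ?_, ?_, ?_, ?_⟩, ?_, ⟨?_, ?_, ?_, ?_, ?_⟩⟩ <;>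
    simp [nilCode, *]

theorem runL_downCode (h : At n L i A B idx 0 σ) :
    At n (L ++ preToks f i) (i + 1) (A - 1) B idx 0 (runL (downCode f) σ) ∧
      (runL (downCode f) σ).arr 0 (i + 1) = 0 ∧ Frame i σ (runL (downCode f) σ) := by
  obtain ⟨r2, r3, r4, r5, r6, r7, r8, r9, henc⟩ := h
  have hupd : ∀ (a : ℕ → ℕ) (v : ℕ), ∀ j ≤ i, Function.update a (i + 1) v j = a j :=
    fun a v j hj => Function.update_of_ne (by omega) _ _
  cases f
  · refine ⟨⟨?_, ?_, ?_, ?_, ?_, ?_, ?_, ?_, ?_⟩, ?_, ⟨?_, ?_, ?_, ?_, ?_⟩⟩ <;>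
      simp [downCode, pushCode, preToks, *] <;> try omega
    · exact henc.mark rfl
    · exact hupd _ _
  · refine ⟨⟨?_, ?_, ?_, ?_, ?_, ?_, ?_, ?_, ?_⟩, ?_, ⟨?_, ?_, ?_, ?_, ?_⟩⟩ <;>
      simp [downCode, pushCode, preToks, *] <;> try omega
    · simpa using (henc.mark (i := i) rfl).toggle (i := i) (m := L.length + 1) (by simp)
    · exact hupd _ _

theorem runL_midCode (h : At n L (i + 1) (A - 1) B idx 1 σ) (hA : 0 < A) :
    ∃ τ, τ = runL midCode (runL upCode σ) ∧
    At n (L ++ [.toggle i]) (i + 1) A (B - 1) idx 0 τ ∧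
      τ.arr 0 (i + 1) = 1 ∧ τ.carr 1 (i + 1) = σ.creg 0 ∧ Frame i σ τ := by
  obtain ⟨r2, r3, r4, r5, r6, r7, r8, r9, henc⟩ := h
  refine ⟨_, rfl, ?_⟩
  have hupd : ∀ (a : ℕ → ℕ) (v : ℕ), ∀ j ≤ i, Function.update a (i + 1) v j = a j :=
    fun a v j hj => Function.update_of_ne (by omega) _ _
  have hupd' : ∀ (a : ℕ → ℂ) (v : ℂ), ∀ j ≤ i, Function.update a (i + 1) v j = a j :=
    fun a v j hj => Function.update_of_ne (by omega) _ _
  have hni : n + (i + 1) - 1 = n + i := by omega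
  refine ⟨⟨?_, ?_, ?_, ?_, ?_, ?_, ?_, ?_, ?_⟩, ?_, ?_, ⟨?_, ?_, ?_, ?_, ?_⟩⟩ <;>
    simp [upCode, midCode, pushCode, *] <;> try omega
  · exact henc.toggle rfl
  · exact hupd _ _
  · exact hupd' _ _

theorem runL_exitCode (h : At n L (i + 1) A (B - 1) idx 1 σ) (hB : 0 < B) {a b : Tree}
    (ha : σ.carr 1 (i + 1) = a.amp) (hb : σ.creg 0 = b.amp) :
    ∃ τ, τ = runL (exitCode f) (runL upCode σ) ∧
    At n (L ++ postToks f i (Tree.angle f a b)) i A B idx 1 τ ∧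
      τ.creg 0 = (Tree.node a b).amp ∧ Frame i σ τ := by
  obtain ⟨r2, r3, r4, r5, r6, r7, r8, r9, henc⟩ := h
  refine ⟨_, rfl, ?_⟩
  have hni : n + (i + 1) - 1 = n + i := by omega
  cases f
  · refine ⟨⟨?_, ?_, ?_, ?_, ?_, ?_, ?_, ?_, ?_⟩, ?_, ⟨?_, ?_, ?_, ?_, ?_⟩⟩ <;>
      simp [upCode, exitCode, rotCode, pushCode, postToks, *] <;> try omega
    · have := ((henc.toggle (i := i) rfl).mark (i := i) (m := L.length + 1) (by simp)).rot (i := i)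
        (m := L.length + 2) (by simp) (rotC (Tree.angle false a b)) (rotS (Tree.angle false a b))
      simpa [rotC, rotS, rotP, Tree.angle, Tree.exc, Tree.amp] using this
    · simp [Tree.amp]
  · refine ⟨⟨?_, ?_, ?_, ?_, ?_, ?_, ?_, ?_, ?_⟩, ?_, ⟨?_, ?_, ?_, ?_, ?_⟩⟩ <;>
      simp [upCode, exitCode, rotCode, pushCode, postToks, *] <;> try omega
    · have := (henc.mark (i := i) rfl).rot (i := i)
        (m := L.length + 1) (by simp) (rotC (Tree.angle true a b)) (rotS (Tree.angle true a b))
      simpa [rotC, rotS, rotP, Tree.angle, Tree.exc, Tree.amp] using this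
    · simp [Tree.amp]

end Rounds

/-! ### Single rounds of the traversal loop, with their step counts -/

section Rounds

variable {f : Bool} {n : ℕ} {L : List Tok} {i A B idx : ℕ} {σ : Store}

theorem steps_leaf (h : At n L i A B idx 0 σ) (hAB : if f then A = 0 ∧ 0 < B else B = 0 ∧ 0 < A) :
    ∃ t τ, Steps (.lt 8 4) (dfsBody f) σ t τ ∧ t ≤ 60 ∧ At n L i A B (idx + 1) 1 τ ∧
      τ.creg 0 = σ.carr 0 idx ∧ Frame i σ τ := by
  have hb : (Test.lt 8 4).holds σ := by simp [Test.holds, h.r8, h.r4]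
  have h8 : (Test.eq 8 9).holds σ := by simp [Test.holds, h.r8, h.r9]
  have e := exec_straight leafCode σ
  cases f
  · have h2 : ¬ (Test.eq 2 9).holds σ := by simp at hAB; simp [Test.holds, h.r2, h.r9]; omega
    have h3 : (Test.eq 3 9).holds σ := by simp at hAB; simp [Test.holds, h.r3, h.r9]; omega
    exact ⟨_, _, .single hb (.iteTrue h8 (.iteFalse h2 (.iteTrue h3 e))), by simp [leafCode],
      runL_leafCode h⟩
  · have h2 : (Test.eq 2 9).holds σ := by simp at hAB; simp [Test.holds, h.r2, h.r9]; omega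
    exact ⟨_, _, .single hb (.iteTrue h8 (.iteTrue h2 e)), by simp [leafCode],
      runL_leafCode h⟩

theorem steps_nil (h : At n L i A B idx 0 σ) (hAB : if f then B = 0 ∧ 0 < A else A = 0 ∧ 0 < B) :
    ∃ t τ, Steps (.lt 8 4) (dfsBody f) σ t τ ∧ t ≤ 60 ∧ At n L i A B idx 1 τ ∧
      τ.creg 0 = 0 ∧ Frame i σ τ := by
  have hb : (Test.lt 8 4).holds σ := by simp [Test.holds, h.r8, h.r4]
  have h8 : (Test.eq 8 9).holds σ := by simp [Test.holds, h.r8, h.r9]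
  have e := exec_straight nilCode σ
  cases f
  · have h2 : (Test.eq 2 9).holds σ := by simp at hAB; simp [Test.holds, h.r2, h.r9]; omega
    exact ⟨_, _, .single hb (.iteTrue h8 (.iteTrue h2 e)), by simp [nilCode],
      runL_nilCode h⟩
  · have h2 : ¬ (Test.eq 2 9).holds σ := by simp at hAB; simp [Test.holds, h.r2, h.r9]; omega
    have h3 : (Test.eq 3 9).holds σ := by simp at hAB; simp [Test.holds, h.r3, h.r9]; omega
    exact ⟨_, _, .single hb (.iteTrue h8 (.iteFalse h2 (.iteTrue h3 e))), by simp [nilCode],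
      runL_nilCode h⟩

theorem steps_down (h : At n L i A B idx 0 σ) (hA : 0 < A) (hB : 0 < B) :
    ∃ t τ, Steps (.lt 8 4) (dfsBody f) σ t τ ∧ t ≤ 60 ∧
      At n (L ++ preToks f i) (i + 1) (A - 1) B idx 0 τ ∧ τ.arr 0 (i + 1) = 0 ∧ Frame i σ τ := by
  have hb : (Test.lt 8 4).holds σ := by simp [Test.holds, h.r8, h.r4]
  have h8 : (Test.eq 8 9).holds σ := by simp [Test.holds, h.r8, h.r9]
  have h2 : ¬ (Test.eq 2 9).holds σ := by simp [Test.holds, h.r2, h.r9]; omega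
  have h3 : ¬ (Test.eq 3 9).holds σ := by simp [Test.holds, h.r3, h.r9]; omega
  exact ⟨_, _, .single hb (.iteTrue h8 (.iteFalse h2 (.iteFalse h3 (exec_straight (downCode f) σ)))),
    by cases f <;> simp [downCode, pushCode], runL_downCode h⟩

theorem steps_mid (h : At n L (i + 1) (A - 1) B idx 1 σ) (hA : 0 < A) (hst : σ.arr 0 (i + 1) = 0) :
    ∃ t τ, Steps (.lt 8 4) (dfsBody f) σ t τ ∧ t ≤ 60 ∧
      At n (L ++ [.toggle i]) (i + 1) A (B - 1) idx 0 τ ∧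
      τ.arr 0 (i + 1) = 1 ∧ τ.carr 1 (i + 1) = σ.creg 0 ∧ Frame i σ τ := by
  have hb : (Test.lt 8 4).holds σ := by simp [Test.holds, h.r8, h.r4]
  have h8 : ¬ (Test.eq 8 9).holds σ := by simp [Test.holds, h.r8, h.r9]
  have h11 : (Test.eq 11 9).holds (runL upCode σ) := by
    simp [Test.holds, upCode, h.r4, h.r9, hst]
  obtain ⟨τ, hτ, hp⟩ := runL_midCode h hA
  have e := exec_straight midCode (runL upCode σ)
  rw [← hτ] at e
  exact ⟨_, τ, .single hb (.iteFalse h8 (.seq (exec_straight upCode σ) (.iteTrue h11 e))),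
    by simp [upCode, midCode, pushCode], hp⟩

theorem steps_exit (h : At n L (i + 1) A (B - 1) idx 1 σ) (hB : 0 < B) {a b : Tree}
    (hst : σ.arr 0 (i + 1) = 1) (ha : σ.carr 1 (i + 1) = a.amp) (hb : σ.creg 0 = b.amp) :
    ∃ t τ, Steps (.lt 8 4) (dfsBody f) σ t τ ∧ t ≤ 60 ∧
      At n (L ++ postToks f i (Tree.angle f a b)) i A B idx 1 τ ∧
      τ.creg 0 = (Tree.node a b).amp ∧ Frame i σ τ := by
  have hl : (Test.lt 8 4).holds σ := by simp [Test.holds, h.r8, h.r4]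
  have h8 : ¬ (Test.eq 8 9).holds σ := by simp [Test.holds, h.r8, h.r9]
  have h11 : ¬ (Test.eq 11 9).holds (runL upCode σ) := by
    simp [Test.holds, upCode, h.r4, h.r9, hst]
  obtain ⟨τ, hτ, hp⟩ := runL_exitCode (f := f) h hB ha hb
  have e := exec_straight (exitCode f) (runL upCode σ)
  rw [← hτ] at e
  exact ⟨_, τ, .single hl (.iteFalse h8 (.seq (exec_straight upCode σ) (.iteFalse h11 e))),
    by cases f <;> simp [upCode, exitCode, rotCode, pushCode], hp⟩

end Rounds

/-- The two per-level arrays serve as the recursion stack. A subtree rooted at level `i + 1` writes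
only to entries beyond `i + 1`, so the entry at `i + 1`, which tells its parent which child is being
visited and the amplitude of the first child, survives both recursive visits. -/
theorem steps_tree {f : Bool} {n : ℕ} (t : Tree) {L : List Tok} {i A B idx : ℕ} {σ : Store}
    (hs : t.Shape f A B) (h : At n L i A B idx 0 σ)
    (hin : ∀ j < t.leaves.length, σ.carr 0 (idx + j) = t.leaves.getD j 0) :
    ∃ s τ, Steps (.lt 8 4) (dfsBody f) σ s τ ∧ s ≤ 240 * t.nodes + 60 ∧
      At n (L ++ t.toks f i) i A B (idx + t.leaves.length) 1 τ ∧ τ.creg 0 = t.amp ∧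
      Frame i σ τ := by
  induction t generalizing L i A B idx σ with
  | nil =>
    obtain ⟨s, τ, h1, h2, h3, h4, h5⟩ := steps_nil h hs
    exact ⟨s, τ, h1, by omega, by simpa [Tree.toks, Tree.leaves] using h3, h4, h5⟩
  | leaf c =>
    obtain ⟨s, τ, h1, h2, h3, h4, h5⟩ := steps_leaf h hs
    refine ⟨s, τ, h1, by omega, by simpa [Tree.toks, Tree.leaves] using h3, ?_, h5⟩
    rw [h4]
    simpa [Tree.leaves, Tree.amp] using hin 0 (by simp [Tree.leaves])
  | node a b iha ihb =>
    obtain ⟨hA, hB, ha, hb⟩ := hs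
    simp only [Tree.leaves, List.length_append] at hin
    obtain ⟨s₁, σ₁, g1, t1, h1, st1, f1⟩ := steps_down (f := f) h hA hB
    obtain ⟨s₂, σ₂, g2, t2, h2, c2, f2⟩ := iha ha h1 (fun j hj => by
      rw [f1.inp, hin j (by omega), List.getD_append _ _ _ _ hj])
    obtain ⟨s₃, σ₃, g3, t3, h3, st3, c3, f3⟩ := steps_mid (f := f) h2 hA
      (by rw [f2.stage _ le_rfl, st1])
    obtain ⟨s₄, σ₄, g4, t4, h4, c4, f4⟩ := ihb hb h3 (fun j hj => by
      rw [f3.inp, f2.inp, f1.inp, Nat.add_assoc, hin _ (by omega),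
        List.getD_append_right _ _ _ _ (by omega), Nat.add_sub_cancel_left])
    obtain ⟨s₅, σ₅, g5, t5, h5, c5, f5⟩ := steps_exit (f := f) h4 hB
      (by rw [f4.stage _ le_rfl, st3]) (by rw [f4.saved _ le_rfl, c3, c2]) c4
    refine ⟨_, σ₅, g1.trans (g2.trans (g3.trans (g4.trans g5))), ?_, ?_, c5, ?_⟩
    -- A node accounts for three rounds of its own, and the additive 60 of two subtrees becomes one:
    -- 180 + 120 = 240 + 60.
    · simp only [Tree.nodes]; omega
    · simpa [Tree.toks, Tree.leaves, Nat.add_assoc] using h5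
    · exact f1.trans ((f2.mono (by omega)).trans (f3.trans ((f4.mono (by omega)).trans f5)))

/-! ### Output of the recorded circuit -/

/-- Output of the controlled reflection recorded at the current position. -/
def emitRotCode : List Instr :=
  [.cload 4 2 7, .cload 5 3 7, .cconj 6 5, .csub 0 4 6, .cadd 1 4 6, .cadd 2 4 5, .csub 3 5 4,
    .csub 7 4 5, .csub 8 6 4, .emitOne 11 7 1 2 8, .emitCnot 12 11, .emitOne 11 0 1 2 3]

/-- Output of the gates of a `mark` step. -/
def emitMarkCode : List Instr :=
  [.emitOne 15 10 11 11 12, .emitCnot 11 15, .emitOne 15 10 11 11 12, .emitCnot 12 15,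
    .emitOne 15 10 11 11 12, .emitCnot 11 15, .emitOne 15 10 11 11 12]

/-- Go to the preceding recorded step. -/
def fetchCode : List Instr :=
  [.subConst 7 7 1, .load 10 1 7, .load 11 2 7, .subConst 11 11 1, .load 12 3 7, .addConst 15 12 1]

/-- Output of one recorded step. -/
def replayBody : Prog :=
  .seq (straight fetchCode)
    (.ite (.eq 10 9) (straight emitMarkCode)
      (.ite (.eq 10 13) (straight [.emitCnot 12 15]) (straight emitRotCode)))

/-- The registers used by the output loop. -/
structure Consts (n : ℕ) (σ : Store) : Prop where
  r0 : σ.reg 0 = n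
  r5 : σ.reg 5 = n
  r9 : σ.reg 9 = 0
  r13 : σ.reg 13 = 1
  r14 : σ.reg 14 = 0
  c10 : σ.creg 10 = cosB
  c11 : σ.creg 11 = sinB
  c12 : σ.creg 12 = 0 - cosB
  c13 : σ.creg 13 = 0
  c14 : σ.creg 14 = 1

theorem exec_replayBody {n : ℕ} {L : List Tok} {k : Tok} {σ : Store} (hc : Consts n σ)
    (h7 : σ.reg 7 = L.length + 1)
    (henc : Enc n (σ.arr 1) (σ.arr 2) (σ.arr 3) (σ.carr 2) (σ.carr 3) (L ++ [k])) :
    ∃ t τ, Exec replayBody σ t τ ∧ t ≤ 30 ∧ Consts n τ ∧ τ.reg 7 = L.length ∧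
      Enc n (τ.arr 1) (τ.arr 2) (τ.arr 3) (τ.carr 2) (τ.carr 3) L ∧
      τ.out = σ.out ++ k.codes n := by
  have hk := henc L.length (by simp)
  have hL : Enc n (σ.arr 1) (σ.arr 2) (σ.arr 3) (σ.carr 2) (σ.carr 3) L := fun j hj => by
    have := henc j (by simp; omega)
    rwa [List.getElem_append_left hj] at this
  obtain ⟨r0, r5, r9, r13, r14, c10, c11, c12, c13, c14⟩ := hc
  have e := exec_straight fetchCode σ
  cases k with
  | mark i =>
    simp only [List.getElem_concat_length, TokAt] at hk
    obtain ⟨k1, k2, k3⟩ := hk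
    have ht : (Test.eq 10 9).holds (runL fetchCode σ) := by
      simp [Test.holds, fetchCode, *]
    refine ⟨_, _, .seq e (.iteTrue ht (exec_straight _ _)), by simp [fetchCode, emitMarkCode],
      ⟨?_, ?_, ?_, ?_, ?_, ?_, ?_, ?_, ?_, ?_⟩, ?_, ?_, ?_⟩ <;>
      simp [fetchCode, emitMarkCode, Tok.codes, markCodes, matB, *]
  | toggle i =>
    simp only [List.getElem_concat_length, TokAt] at hk
    obtain ⟨k1, k2, k3⟩ := hk
    have ht : ¬ (Test.eq 10 9).holds (runL fetchCode σ) := by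
      simp [Test.holds, fetchCode, *]
    have ht' : (Test.eq 10 13).holds (runL fetchCode σ) := by
      simp [Test.holds, fetchCode, *]
    refine ⟨_, _, .seq e (.iteFalse ht (.iteTrue ht' (exec_straight _ _))), by simp [fetchCode],
      ⟨?_, ?_, ?_, ?_, ?_, ?_, ?_, ?_, ?_, ?_⟩, ?_, ?_, ?_⟩ <;>
      simp [fetchCode, Tok.codes, *]
  | rot i c s =>
    simp only [List.getElem_concat_length, TokAt] at hk
    obtain ⟨k1, k2, k3, k4, k5⟩ := hk
    have ht : ¬ (Test.eq 10 9).holds (runL fetchCode σ) := by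
      simp [Test.holds, fetchCode, *]
    have ht' : ¬ (Test.eq 10 13).holds (runL fetchCode σ) := by
      simp [Test.holds, fetchCode, *]
    refine ⟨_, _, .seq e (.iteFalse ht (.iteFalse ht' (exec_straight _ _))),
      by simp [fetchCode, emitRotCode],
      ⟨?_, ?_, ?_, ?_, ?_, ?_, ?_, ?_, ?_, ?_⟩, ?_, ?_, ?_⟩ <;>
      simp [fetchCode, emitRotCode, Tok.codes, rotCodes, *]

/-- The record is used as a stack, which produces the reversal in `revCodes`; hence the induction
removes the last element. -/
theorem exec_replay {n : ℕ} {L : List Tok} {σ : Store} (hc : Consts n σ)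
    (h7 : σ.reg 7 = L.length)
    (henc : Enc n (σ.arr 1) (σ.arr 2) (σ.arr 3) (σ.carr 2) (σ.carr 3) L) :
    ∃ t τ, Exec (.loop (.lt 9 7) replayBody) σ t τ ∧ t ≤ 31 * L.length + 1 ∧ Consts n τ ∧
      τ.out = σ.out ++ revCodes n L := by
  induction L using List.reverseRecOn generalizing σ with
  | nil =>
    exact ⟨1, σ, .loopDone (by simp [Test.holds, h7, hc.r9]), by simp, hc, by simp⟩
  | append_singleton L k ih =>
    rw [List.length_append, List.length_singleton] at h7
    obtain ⟨t, τ, e, ht, hc', h7', henc', ho⟩ := exec_replayBody hc h7 henc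
    obtain ⟨u, υ, e', hu, hc'', ho'⟩ := ih hc' h7' henc'
    refine ⟨_, υ, .loopStep (by simp [Test.holds, h7, hc.r9]) e e', ?_, hc'', ?_⟩
    · rw [List.length_append, List.length_singleton]; omega
    · rw [ho', ho]; simp

/-- Output of a Pauli `X` gate on every input qubit. -/
def flipLoop : Prog := .loop (.lt 14 0) (straight [.emitOne 14 13 14 14 13, .addConst 14 14 1])

theorem exec_flipLoop {m : ℕ} : ∀ {i n : ℕ} {σ : Store}, i + m = n → σ.reg 0 = n → σ.reg 14 = i →
    σ.creg 13 = 0 → σ.creg 14 = 1 → ∃ t τ, Exec flipLoop σ t τ ∧ t ≤ 4 * m + 1 ∧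
      τ.out = σ.out ++ (List.range' i m).map fun j => .one j matX := by
  induction m with
  | zero =>
    intro i n σ hi h0 h14 _ _
    exact ⟨1, σ, .loopDone (by simp [Test.holds, h0, h14]; omega), le_rfl, by simp⟩
  | succ m ih =>
    intro i n σ hi h0 h14 c13 c14
    have e := exec_straight [.emitOne 14 13 14 14 13, .addConst 14 14 1] σ
    obtain ⟨t, τ, e', ht, ho⟩ := @ih (i + 1) n
      (runL [.emitOne 14 13 14 14 13, .addConst 14 14 1] σ) (by omega) (by simpa using h0)
      (by simp [h14]) (by simpa using c13) (by simpa using c14)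
    refine ⟨_, τ, .loopStep (by simp [Test.holds, h0, h14]; omega) e e', ?_, ?_⟩
    · simp; omega
    · rw [ho]
      simp [List.range'_succ, h14, c13, c14, matX]

/-! ### The program -/

/-- Start of the traversal at the root. -/
def setupCode (f : Bool) : List Instr :=
  [.addConst 2 14 (if f then 0 else 1), .addConst 3 1 (if f then 1 else 0), .const 4 1,
    .addConst 5 0 0]

/-- The constants of the gates, and the flag of the root. -/
def constCode : List Instr :=
  [.const 13 1, .const 14 0, .cconst 0 (1 / 2) 0, .csqrt 0 0, .cconst 1 1 0, .cconst 2 2 0,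
    .csub 3 1 0, .cdiv 3 3 2, .csqrt 10 3, .cadd 3 1 0, .cdiv 3 3 2, .csqrt 11 3, .cconst 13 0 0,
    .csub 12 13 10, .cconst 14 1 0, .emitOne 5 13 14 14 13]

/-- The program for a given exceptional bit, after the computation of `n - k`. -/
def mainProg (f : Bool) : Prog :=
  .seq (straight (setupCode f)) (.seq (.loop (.lt 8 4) (dfsBody f)) (.seq (straight constCode)
    (.seq (.loop (.lt 9 7) replayBody) (.seq (straight [.emitOne 5 13 14 14 13])
      (if f then flipLoop else .instr .skip)))))

/-- The loop that computes `n - k`. -/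
def subLoop : Prog := .loop (.lt 2 0) (straight [.addConst 2 2 1, .addConst 14 14 1])

/-- The program for `k = 0`. -/
def phaseCode : List Instr := [.cload 0 0 9, .cconst 1 0 0, .emitOne 9 0 1 1 0]

/-- The program that outputs the circuit. -/
def u1Prog : Prog :=
  .ite (.eq 1 9) (straight phaseCode)
    (.seq (.instr (.addConst 2 1 0)) (.seq subLoop (.ite (.lt 14 1) (mainProg true)
      (mainProg false))))

theorem exec_mainProg {f : Bool} {n k : ℕ} {t : Tree}
    (ht : if f then t.Shape f (n - k) (k + 1) else t.Shape f (n - k + 1) k) {σ : Store}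
    (h0 : σ.reg 0 = n) (h1 : σ.reg 1 = k) (h14 : σ.reg 14 = n - k) (h6 : σ.reg 6 = 0)
    (h7 : σ.reg 7 = 0) (h8 : σ.reg 8 = 0) (h9 : σ.reg 9 = 0) (hout : σ.out = [])
    (hin : ∀ j < t.leaves.length, σ.carr 0 j = t.leaves.getD j 0) :
    ∃ s τ, Exec (mainProg f) σ s τ ∧ s ≤ 395 * t.nodes + 4 * n + 150 ∧
      τ.out = fullCodes f n t := by
  have e₁ := exec_straight (setupCode f) σ
  obtain ⟨A, B, hAB, ha, hb⟩ : ∃ A B, t.Shape f A B ∧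
      A = n - k + (if f then 0 else 1) ∧ B = k + (if f then 1 else 0) := by
    cases f
    · exact ⟨_, _, ht, rfl, rfl⟩
    · exact ⟨_, _, ht, rfl, rfl⟩
  have hat : At n [] 0 A B 0 0 (runL (setupCode f) σ) := by
    constructor <;> simp [setupCode, Enc, *]
  obtain ⟨s₂, σ₂, e₂, t₂, a₂, -, f₂⟩ := steps_tree t hAB hat (fun j hj => by
    rw [Nat.zero_add, ← hin j hj]; simp [setupCode])
  -- The level is stored as `i + 1` so that a single comparison detects the end: mode < level + 1
  -- fails only on the way up (mode 1) at the root (level 0).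
  have e₂' := e₂.exec_loop (by simp [Test.holds, a₂.r8, a₂.r4])
  have e₃ := exec_straight constCode σ₂
  have ho₂ : σ₂.out = [] := by rw [f₂.out]; simpa [setupCode] using hout
  have h0₂ : σ₂.reg 0 = n := by rw [f₂.r0]; simpa [setupCode] using h0
  have ho₃ : (runL constCode σ₂).out = [.one n matX] := by
    simp [constCode, ho₂, a₂.r5, matX]
  have hc : Consts n (runL constCode σ₂) := by
    constructor <;> simp [constCode, h0₂, a₂.r5, a₂.r9, cosB, sinB, rtHalf]
  obtain ⟨s₄, σ₄, e₄, t₄, hc₄, ho₄⟩ := exec_replay (L := t.toks f 0) hc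
    (by simpa [constCode] using a₂.r7) (by simpa [constCode] using a₂.enc)
  have e₅ := exec_straight [.emitOne 5 13 14 14 13] σ₄
  rw [t.length_toks] at t₄
  have hX : (runL [.emitOne 5 13 14 14 13] σ₄).out =
      [.one n matX] ++ (revCodes n (t.toks f 0) ++ [.one n matX]) := by
    simp [hc₄.r5, hc₄.c13, hc₄.c14, ho₄, ho₃, matX]
  obtain ⟨s₆, τ, e₆, t₆, ho₆⟩ : ∃ s τ, Exec (if f then flipLoop else .instr .skip)
      (runL [.emitOne 5 13 14 14 13] σ₄) s τ ∧ s ≤ 4 * n + 1 ∧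
      τ.out = (runL [.emitOne 5 13 14 14 13] σ₄).out ++
        (if f then (List.range n).map fun i => .one i matX else []) := by
    cases f
    · exact ⟨1, _, .instr _ _, by omega, by simp [Instr.exec]⟩
    · have := exec_flipLoop (m := n) (i := 0) (n := n)
        (σ := runL [.emitOne 5 13 14 14 13] σ₄) (by omega) (by simp [hc₄.r0]) (by simp [hc₄.r14])
        (by simp [hc₄.c13]) (by simp [hc₄.c14])
      rw [← List.range_eq_range'] at this
      simpa using this
  refine ⟨_, τ, .seq e₁ (.seq e₂' (.seq e₃ (.seq e₄ (.seq e₅ e₆)))), ?_, ?_⟩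
  -- 395 = 240 + 5 · 31: traversal, plus output of five recorded steps per node.
  · simp only [setupCode, constCode, List.length_cons, List.length_nil]
    omega
  · rw [ho₆, hX]
    simp [fullCodes]

/-- Two registers cannot be subtracted from each other, so `n - k` is found by counting up from `k`
to `n`. -/
theorem exec_subLoop {m : ℕ} : ∀ {c : ℕ} {σ : Store}, σ.reg 2 + m = σ.reg 0 → σ.reg 14 = c →
    ∃ t τ, Exec subLoop σ t τ ∧ t ≤ 4 * m + 1 ∧ τ.reg 14 = c + m ∧ τ.out = σ.out ∧
      τ.carr = σ.carr ∧ ∀ r, r ≠ 2 → r ≠ 14 → τ.reg r = σ.reg r := by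
  induction m with
  | zero =>
    intro c σ h hc
    exact ⟨1, σ, .loopDone (by simp [Test.holds]; omega), le_rfl, hc, rfl, rfl, fun _ _ _ => rfl⟩
  | succ m ih =>
    intro c σ h hc
    have e := exec_straight [.addConst 2 2 1, .addConst 14 14 1] σ
    obtain ⟨t, τ, e', ht, h1, h2, h3, h4⟩ := @ih (c + 1)
      (runL [.addConst 2 2 1, .addConst 14 14 1] σ) (by simp; omega) (by simp [hc])
    refine ⟨_, τ, .loopStep (by simp [Test.holds]; omega) e e', ?_, by omega, ?_, ?_, ?_⟩
    · simp; omega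
    · simpa using h2
    · simpa using h3
    · intro r hr hr'
      rw [h4 r hr hr']
      simp [hr, hr']

theorem exec_u1Prog_of_pos {f : Bool} {n k : ℕ} (hk : 1 ≤ k) (hkn : k < n) {ψ : QVec n}
    (hf : f = true ↔ n - k < k) {t : Tree}
    (ht : if f then t.Shape f (n - k) (k + 1) else t.Shape f (n - k + 1) k)
    (hl : t.leaves = (weightList n k).map ψ) :
    ∃ s τ, Exec u1Prog (input k ψ) s τ ∧ s ≤ 395 * t.nodes + 8 * n + 160 ∧
      τ.out = fullCodes f n t := by
  have hne : ¬ (Test.eq 1 9).holds (input k ψ) := by simp [Test.holds, input]; omega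
  obtain ⟨s₁, σ₁, e₁, t₁, h14, ho, hcarr, hr⟩ := exec_subLoop (m := n - k) (c := 0)
    (σ := (Instr.addConst 2 1 0).exec (input k ψ)) (by simp [input]; omega) (by simp [input])
  have h1 : σ₁.reg 1 = k := by rw [hr 1 (by simp) (by simp)]; simp [input]
  obtain ⟨s₂, τ, e₂, t₂, ho₂⟩ := exec_mainProg ht (σ := σ₁)
    (by rw [hr 0 (by simp) (by simp)]; simp [input]) h1 (by omega)
    (by rw [hr 6 (by simp) (by simp)]; simp [input])
    (by rw [hr 7 (by simp) (by simp)]; simp [input])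
    (by rw [hr 8 (by simp) (by simp)]; simp [input])
    (by rw [hr 9 (by simp) (by simp)]; simp [input])
    (by rw [ho]; simp [input])
    (fun j _ => by rw [hcarr, hl]; simp [input])
  have e₃ : Exec (.ite (.lt 14 1) (mainProg true) (mainProg false)) σ₁ (s₂ + 1) τ := by
    cases f
    · refine .iteFalse ?_ e₂
      have : ¬ n - k < k := fun h => by simpa using hf.mpr h
      simp only [Test.holds]
      omega
    · refine .iteTrue ?_ e₂
      have : n - k < k := hf.mp rfl
      simp only [Test.holds]
      omega
  exact ⟨_, τ, .iteFalse hne (.seq (.instr _ _) (.seq e₁ e₃)), by omega, ho₂⟩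

theorem exec_u1Prog_zero {n : ℕ} (ψ : QVec n) :
    ∃ τ, Exec u1Prog (input 0 ψ) 5 τ ∧
      τ.out = [.one 0 (mat (ψ fun _ => false) 0 0 (ψ fun _ => false))] := by
  refine ⟨_, .iteTrue (by simp [Test.holds, input]) (exec_straight phaseCode _), ?_⟩
  simp [phaseCode, input, weightList_eq, lexList_zero]

/-- The only string of weight 0 has an amplitude of modulus 1, so the required gate is this scalar
times the identity. -/
theorem prepares_zero {n : ℕ} (hn : 0 < n) {ψ : QVec n} (hψ : IsU1State 0 ψ) :
    GateCode.Valid (n + (n + 1)) (.one 0 (mat (ψ fun _ => false) 0 0 (ψ fun _ => false))) ∧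
    codeRun (n + (n + 1)) [.one 0 (mat (ψ fun _ => false) 0 0 (ψ fun _ => false))]
      (tensor (zeroState n) (zeroState (n + 1))) = tensor ψ (zeroState (n + 1)) := by
  have hsum : ∀ {M : Type} [AddCommMonoid M] (g : (Fin n → Bool) → M),
      (∀ x, weight x ≠ 0 → g x = 0) → ∑ x, g x = g fun _ => false := by
    intro M _ g hg
    rw [← sum_weightList g hg, weightList_eq, lexList_zero]
    simp
  have hc : ‖ψ fun _ => false‖ ^ 2 = 1 := by
    rw [← hψ.normalized, hsum]
    intro x hx
    simp [hψ.support x hx]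
  have hcc : (ψ fun _ => false) * starRingEnd ℂ (ψ fun _ => false) = 1 := by
    rw [Complex.mul_conj, Complex.normSq_eq_norm_sq, hc, Complex.ofReal_one]
  refine ⟨⟨by omega, mat_mem_unitaryGroup (by simpa using hcc) (by simp) (by simpa using hcc)⟩, ?_⟩
  rw [tensor_zeroState, tensor_eq_sum, hsum, codeRun_cons, codeRun_nil, lin_one_ket (by omega)]
  · have h : overlay false 0 (fun _ : Fin n => false) (fun _ => false) = fun _ => false := by
      ext j; simp [overlay]
    simp [h]
  · intro x hx
    simp [hψ.support x hx]

end U1Prep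

/-! ### Assembly of the circuit and running-time bounds -/

theorem mainTheorem4 :
    ∃ (P : U1Prep.Prog) (a : ℕ) (K : ℝ),
      ∀ (n k : ℕ), 2 ≤ n → k < n →
        ∀ ψ : U1Prep.QVec n, U1Prep.IsU1State k ψ →
          ∃ (m : ℕ) (C : U1Prep.Circuit (n + m)),
            m ≤ a * n ∧
            U1Prep.Prepares C ψ ∧
            (C.length : ℝ) ≤ K * ((n.choose k : ℝ) * Real.logb 2 n) ∧
            ∃ (t : ℕ) (τ : U1Prep.Store),
              U1Prep.Exec P (U1Prep.input k ψ) t τ ∧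
              τ.out = C.map U1Prep.Gate.code ∧
              (t : ℝ) ≤ K * ((n.choose k : ℝ) * Real.logb 2 n) := by
  -- There are `n + 1 ≤ 2 n` ancillas. With `nodes < 2 * n.choose k` and `n ≤ n.choose k`, the time
  -- is at most (790 + 8 + 160) `n.choose k`, below 1000 `n.choose k`.
  refine ⟨U1Prep.u1Prog, 2, 1000, fun n k hn hkn ψ hψ => ?_⟩
  have hlog : 1 ≤ Real.logb 2 n := by
    rw [Real.le_logb_iff_rpow_le one_lt_two (by exact_mod_cast (by omega : 0 < n)), Real.rpow_one]
    exact_mod_cast hn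
  have hbound : ∀ s : ℕ, s ≤ 1000 * n.choose k →
      (s : ℝ) ≤ 1000 * ((n.choose k : ℝ) * Real.logb 2 n) := by
    intro s hs
    have h1 : (s : ℝ) ≤ 1000 * (n.choose k : ℝ) := by exact_mod_cast hs
    have h2 : (n.choose k : ℝ) * 1 ≤ n.choose k * Real.logb 2 n :=
      mul_le_mul_of_nonneg_left hlog (Nat.cast_nonneg _)
    linarith
  have hpos : 0 < n.choose k := Nat.choose_pos hkn.le
  rcases Nat.eq_zero_or_pos k with rfl | hk
  · obtain ⟨hv, hrun⟩ := U1Prep.prepares_zero (by omega) hψ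
    obtain ⟨τ, he, ho⟩ := U1Prep.exec_u1Prog_zero ψ
    obtain ⟨C, hC⟩ := U1Prep.exists_circuit _ (List.forall_mem_singleton.mpr hv)
    refine ⟨n + 1, C, by omega, ?_, hbound _ ?_, 5, τ, he, by rw [hC, ho], hbound _ (by omega)⟩
    · rw [U1Prep.Prepares, U1Prep.Circuit.run_eq_codeRun, hC, hrun]
    · rw [← List.length_map U1Prep.Gate.code, hC, List.length_singleton]
      omega
  -- The default bit is the majority bit, as the node count demands; the program makes the same
  -- choice by its test on `n - k` and `k`.
  · obtain ⟨f, hf⟩ : ∃ f : Bool, f = true ↔ n - k < k := ⟨decide (n - k < k), decide_eq_true_iff⟩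
    obtain ⟨T, hs, hl, hrun⟩ := U1Prep.exists_tree hk hkn hψ f
    have hnodes := U1Prep.nodes_le hk hkn hf hs
    have hnc := U1Prep.le_choose hk hkn
    obtain ⟨s, τ, he, hst, ho⟩ := U1Prep.exec_u1Prog_of_pos hk hkn hf hs hl
    have hv : ∀ g ∈ U1Prep.fullCodes f n T, g.Valid (n + (n + 1)) := by
      cases f
      · exact U1Prep.valid_fullCodes hs (by omega)
      · exact U1Prep.valid_fullCodes hs (by omega)
    obtain ⟨C, hC⟩ := U1Prep.exists_circuit _ hv
    have hlen := U1Prep.length_fullCodes_le f n T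
    refine ⟨n + 1, C, by omega, ?_, hbound _ ?_, s, τ, he, by rw [hC, ho], hbound _ (by omega)⟩
    · rw [U1Prep.Prepares, U1Prep.Circuit.run_eq_codeRun, hC, hrun]
    · rw [← List.length_map U1Prep.Gate.code, hC]
      omega
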